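/- **Setting.** Let $(X,Y_+,Y_-)$ be a random triple (assignment variable, potential outcome under treatment, potential outcome under control) and let $t\in\mathbb R$ be a threshold. Write $\mu_\pm(x)=\mathbb E(Y_\pm\mid X=x)$, $\sigma_\pm^2(x)=\operatorname{Var}(Y_\pm\mid X=x)$ and $\tau_{\rm thresh}=\mu_+(t)-\mu_-(t)$. Assume that $X$ has a density $f$ that is continuously differentiable at $t$ with $f(t)>0$; that $\mu_\pm$ are three times continuously differentiable in a neighborhood of $t$; that $\sigma_\pm^2$ are finite and bounded in a neighborhood of $t$, and continuous and strictly positive at $t$; and that $\mu_+''(t)\ne\mu_-''(t)$. Let $K:\mathbb R\to[0,\infty)$ be a symmetric bounded kernel that vanishes outside $[-1,1]$, is continuous on $[-1,1]$ and is strictly positive somewhere. **Designs.** In an experiment the subjects $i=1,2,\dots$ are independent, with $(X_i,Y_{i+},Y_{i-})$ distributed as $(X,Y_+,Y_-)$; subject $i$ gets $Z_i\in\{1,-1\}$, where, given $(X_i,Y_{i+},Y_{i-})$, $Z_i=1$ with a probability $e(X_i)$ that depends only on $X_i$, and the outcome $Y_i=Y_{i+}$ is observed if $Z_i=1$, $Y_i=Y_{i-}$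 if $Z_i=-1$. The regression discontinuity design (RDD) has $e(x)=1$ for $x>t$ and $e(x)=0$ otherwise. The tie-breaker design TBD$(p)$ with radius $\Delta>0$ and $p\in(0,1)$ has $e(x)=0$ for $x-t\le-\Delta$, $e(x)=p$ for $|x-t|<\Delta$, and $e(x)=1$ for $x-t\ge\Delta$. **Estimator.** From $N$ subjects and a bandwidth $h$, let $\hat\beta$ minimize $\sum_{i=1}^N K\big(\tfrac{X_i-t}{h}\big)\big(Y_i-(\beta_1+\beta_2X_i+\beta_3Z_i+\beta_4X_iZ_i)\big)^2$ over $\beta\in\mathbb R^4$, and let $\hat\tau_h=2\hat\beta_3+2\hat\beta_4t$. Let $\mathrm{MSE}(h,N)=\mathbb E\big[(\hat\tau_h-\tau_{\rm thresh})^2\mid (X_i,Z_i)_{i\le N}\big]$, a random function of $h$ (computed from the regular conditional distribution of the outcomes given the design); at a random bandwidth $\hat h$, $\mathrm{MSE}(\hat h,N)$ is the value of this function at $\hat h$. Indices RDD and TBD$(p)$ indicate the design. **Constants.** Put $\nu_j=\int_{-\infty}^\infty u^jK(u)\,du$, $\pi_j=\int_{-\infty}^\infty u^jK^2(u)\,du$,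 $\tilde\nu_j=\int_0^\infty u^jK(u)\,du$, $\tilde\pi_j=\int_0^\infty u^jK^2(u)\,du$, $$C_1=\tfrac14\Big(\frac{\nu_2^2-\nu_1\nu_3}{\nu_0\nu_2-\nu_1^2}\Big)^2,\qquad C_2=\frac{2\nu_2^2\pi_0-4\nu_1\nu_2\pi_1+2\nu_1^2\pi_2}{(\nu_2\nu_0-\nu_1^2)^2},$$ $$\tilde C_1=\tfrac14\Big(\frac{\tilde\nu_2^2-\tilde\nu_1\tilde\nu_3}{\tilde\nu_0\tilde\nu_2-\tilde\nu_1^2}\Big)^2,\qquad \tilde C_2=\frac{\tilde\nu_2^2\tilde\pi_0-2\tilde\nu_1\tilde\nu_2\tilde\pi_1+\tilde\nu_1^2\tilde\pi_2}{(\tilde\nu_2\tilde\nu_0-\tilde\nu_1^2)^2}.$$ **Bandwidths.** Let $$\gamma=\Big(\frac{\sigma_+^2(t)+\sigma_-^2(t)}{f(t)(\mu_+''(t)-\mu_-''(t))^2}\Big)^{1/5},\qquad \gamma_p=\Big(\frac{\frac1{2p}\sigma_+^2(t)+\frac1{2(1-p)}\sigma_-^2(t)}{f(t)(\mu_+''(t)-\mu_-''(t))^2}\Big)^{1/5},$$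 let $\hat\gamma_{\rm RDD}$ and $\hat\gamma_{{\rm TBD}(p)}$ (depending on the sample size) be any consistent estimators of $\gamma$ and $\gamma_p$, that is, converging to them in probability, and put $$\hat h_{\rm opt,RDD}(N)=\Big(\frac{\tilde C_2}{4\tilde C_1}\Big)^{1/5}\hat\gamma_{\rm RDD}N^{-1/5},\qquad \hat h_{{\rm opt,TBD}(p)}(N)=\Big(\frac{C_2}{4C_1}\Big)^{1/5}\hat\gamma_{{\rm TBD}(p)}N^{-1/5}.$$ **Theorem.** Let $p\in(0,1)$, $\Delta>0$, $\theta>0$, and let $m_N$ be integers with $m_N/N\to\theta$ (for example $m_N=\lfloor\theta N\rfloor$, that is, $\theta N$ subjects up to rounding). Consider an RDD with $N$ subjects and a TBD$(p)$ with $m_N$ subjects from the same superpopulation. As $N\to\infty$, $$\frac{\mathrm{MSE}_{\rm RDD}\big(\hat h_{\rm opt,RDD}(N),N\big)}{\mathrm{MSE}_{{\rm TBD}(p)}\big(\hat h_{{\rm opt,TBD}(p)}(m_N),m_N\big)}\ \xrightarrow{\ p\ }\ \theta^{4/5}\Big(\frac{\tilde C_1\tilde C_2^4}{C_1C_2^4}\Big)^{1/5}\Big(\frac{r(t)}{2p}+\frac{1-r(t)}{2(1-p)}\Big)^{-4/5},\qquad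 r(t)=\frac{\sigma_+^2(t)}{\sigma_+^2(t)+\sigma_-^2(t)}.$$ -/

import Mathlib

open MeasureTheory ProbabilityTheory Filter Topology

noncomputable section

namespace TieBreaker

/-! ### The superpopulation -/

/-- The joint law of `(X, Y₊, Y₋)`: the assignment variable `X` has a density, and `cond x` is the
conditional law of the pair of potential outcomes `(Y₊, Y₋)` given `X = x`. -/
structure Superpopulation where
  density : ℝ → ℝ
  measurable_density : Measurable density
  density_nonneg : ∀ x, 0 ≤ density x
  lintegral_density : ∫⁻ x, ENNReal.ofReal (density x) = 1
  cond : Kernel ℝ (ℝ × ℝ)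
  markov_cond : IsMarkovKernel cond

namespace Superpopulation

variable (pop : Superpopulation)

/-- The joint law of `(X, (Y₊, Y₋))`. -/
def law : Measure (ℝ × (ℝ × ℝ)) :=
  (volume.withDensity fun x => ENNReal.ofReal (pop.density x)) ⊗ₘ pop.cond

/-- `μ₊(x) = E(Y₊ | X = x)`. -/
def meanPlus (x : ℝ) : ℝ := ∫ y, y.1 ∂(pop.cond x)

/-- `μ₋(x) = E(Y₋ | X = x)`. -/
def meanMinus (x : ℝ) : ℝ := ∫ y, y.2 ∂(pop.cond x)

/-- `σ₊²(x) = Var(Y₊ | X = x)`. -/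
def varPlus (x : ℝ) : ℝ := variance (fun y : ℝ × ℝ => y.1) (pop.cond x)

/-- `σ₋²(x) = Var(Y₋ | X = x)`. -/
def varMinus (x : ℝ) : ℝ := variance (fun y : ℝ × ℝ => y.2) (pop.cond x)

/-- The estimand `τ_thresh = μ₊(t) - μ₋(t)`. -/
def tauThresh (t : ℝ) : ℝ := pop.meanPlus t - pop.meanMinus t

/-- The difference `μ₊''(t) - μ₋''(t)` of the second derivatives. -/
def curvatureGap (t : ℝ) : ℝ :=
  iteratedDeriv 2 pop.meanPlus t - iteratedDeriv 2 pop.meanMinus t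

/-- The regularity conditions on the superpopulation at the threshold `t`. -/
structure IsRegularAt (t : ℝ) : Prop where
  density_differentiable : ∀ᶠ x in 𝓝 t, DifferentiableAt ℝ pop.density x
  density_deriv_continuous : ContinuousAt (deriv pop.density) t
  density_pos : 0 < pop.density t
  meanPlus_contDiff : ContDiffAt ℝ 3 pop.meanPlus t
  meanMinus_contDiff : ContDiffAt ℝ 3 pop.meanMinus t
  /- the conditional second moments exist near `t` -/
  memLp_plus : ∀ᶠ x in 𝓝 t, MemLp (fun y : ℝ × ℝ => y.1) 2 (pop.cond x)
  memLp_minus : ∀ᶠ x in 𝓝 t, MemLp (fun y : ℝ × ℝ => y.2) 2 (pop.cond x)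
  varPlus_bounded : ∃ B : ℝ, ∀ᶠ x in 𝓝 t, pop.varPlus x ≤ B
  varMinus_bounded : ∃ B : ℝ, ∀ᶠ x in 𝓝 t, pop.varMinus x ≤ B
  varPlus_continuous : ContinuousAt pop.varPlus t
  varMinus_continuous : ContinuousAt pop.varMinus t
  varPlus_pos : 0 < pop.varPlus t
  varMinus_pos : 0 < pop.varMinus t
  curvature_ne : iteratedDeriv 2 pop.meanPlus t ≠ iteratedDeriv 2 pop.meanMinus t

/-- The quantity `γ` on which the optimal bandwidth of the regression discontinuity design
depends. -/
def gammaRDD (t : ℝ) : ℝ :=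
  ((pop.varPlus t + pop.varMinus t) / (pop.density t * pop.curvatureGap t ^ 2)) ^ (1 / 5 : ℝ)

/-- The quantity on which the optimal bandwidth of the tie-breaker design with treatment
probability `p` depends. -/
def gammaTBD (t p : ℝ) : ℝ :=
  ((1 / (2 * p) * pop.varPlus t + 1 / (2 * (1 - p)) * pop.varMinus t) /
    (pop.density t * pop.curvatureGap t ^ 2)) ^ (1 / 5 : ℝ)

/-- The relative variance `r(t) = σ₊²(t) / (σ₊²(t) + σ₋²(t))`. -/
def relVar (t : ℝ) : ℝ := pop.varPlus t / (pop.varPlus t + pop.varMinus t)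

end Superpopulation

/-! ### Kernels and their constants -/

/-- The conditions on the (deterministic) smoothing kernel `K`. -/
structure IsSmoothingKernel (K : ℝ → ℝ) : Prop where
  nonneg : ∀ u, 0 ≤ K u
  symmetric : ∀ u, K (-u) = K u
  bounded : ∃ B : ℝ, ∀ u, K u ≤ B
  support : ∀ u, 1 < |u| → K u = 0
  continuousOn : ContinuousOn K (Set.Icc (-1) 1)
  pos_somewhere : ∃ u, 0 < K u

/-- `ν_j`. -/
def nu (K : ℝ → ℝ) (j : ℕ) : ℝ := ∫ u, u ^ j * K u

/-- `π_j`. -/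
def kpi (K : ℝ → ℝ) (j : ℕ) : ℝ := ∫ u, u ^ j * K u ^ 2

/-- `ν̃_j`, the one-sided version of `ν_j`. -/
def nuTilde (K : ℝ → ℝ) (j : ℕ) : ℝ := ∫ u in Set.Ioi (0 : ℝ), u ^ j * K u

/-- `π̃_j`, the one-sided version of `π_j`. -/
def kpiTilde (K : ℝ → ℝ) (j : ℕ) : ℝ := ∫ u in Set.Ioi (0 : ℝ), u ^ j * K u ^ 2

/-- `C₁`. -/
def C1 (K : ℝ → ℝ) : ℝ :=
  1 / 4 * ((nu K 2 ^ 2 - nu K 1 * nu K 3) / (nu K 0 * nu K 2 - nu K 1 ^ 2)) ^ 2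

/-- `C₂`. -/
def C2 (K : ℝ → ℝ) : ℝ :=
  (2 * nu K 2 ^ 2 * kpi K 0 - 4 * nu K 1 * nu K 2 * kpi K 1 + 2 * nu K 1 ^ 2 * kpi K 2) /
    (nu K 2 * nu K 0 - nu K 1 ^ 2) ^ 2

/-- `C̃₁`. -/
def C1Tilde (K : ℝ → ℝ) : ℝ :=
  1 / 4 * ((nuTilde K 2 ^ 2 - nuTilde K 1 * nuTilde K 3) /
    (nuTilde K 0 * nuTilde K 2 - nuTilde K 1 ^ 2)) ^ 2

/-- `C̃₂`. -/
def C2Tilde (K : ℝ → ℝ) : ℝ :=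
  (nuTilde K 2 ^ 2 * kpiTilde K 0 - 2 * nuTilde K 1 * nuTilde K 2 * kpiTilde K 1 +
    nuTilde K 1 ^ 2 * kpiTilde K 2) / (nuTilde K 2 * nuTilde K 0 - nuTilde K 1 ^ 2) ^ 2

/-! ### Experimental designs -/

/-- Treatment probability of the regression discontinuity design: treat exactly if `x > t`. -/
def rddProb (t x : ℝ) : ℝ := if t < x then 1 else 0

/-- Treatment probability of the tie-breaker design with experimental radius `Δ` and treatment
probability `p` inside the experimental window. -/
def tbdProb (t Δ p x : ℝ) : ℝ :=
  if x - t ≤ -Δ then 0 else if |x - t| < Δ then p else 1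

/-- Subjects `i = 0, 1, 2, …` with assignment variables `X i`, potential outcomes `Yp i`, `Ym i`
and treatments `Z i ∈ {1, -1}`: the subjects are independent, each triple `(X i, Yp i, Ym i)` is
drawn from the superpopulation, and `Z i = 1` is decided by randomization with probability
`e (X i)`, whatever the potential outcomes are. -/
structure IsExperiment {Ω : Type*} [MeasurableSpace Ω] (P : Measure Ω) (pop : Superpopulation)
    (e : ℝ → ℝ) (X Yp Ym Z : ℕ → Ω → ℝ) : Prop where
  measurable_X : ∀ i, Measurable (X i)
  measurable_Yp : ∀ i, Measurable (Yp i)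
  measurable_Ym : ∀ i, Measurable (Ym i)
  measurable_Z : ∀ i, Measurable (Z i)
  treatment : ∀ i ω, Z i ω = 1 ∨ Z i ω = -1
  indep : iIndepFun (fun i ω => ((X i ω, (Yp i ω, Ym i ω)), Z i ω)) P
  law : ∀ i, P.map (fun ω => (X i ω, (Yp i ω, Ym i ω))) = pop.law
  assignment : ∀ i,
    P[Set.indicator {ω | Z i ω = 1} (fun _ => (1 : ℝ)) |
      MeasurableSpace.comap (fun ω => (X i ω, (Yp i ω, Ym i ω))) inferInstance]
      =ᵐ[P] fun ω => e (X i ω)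

/-! ### The local linear estimator and its mean squared error -/

/-- The kernel-weighted sum of squares at the coefficient vector `β`; `d i = (x_i, z_i)` and `y i`
are the design point and the observed outcome of subject `i`. -/
def weightedLoss (K : ℝ → ℝ) (t h : ℝ) {N : ℕ} (d : Fin N → ℝ × ℝ) (y : Fin N → ℝ)
    (β : Fin 4 → ℝ) : ℝ :=
  ∑ i, K (((d i).1 - t) / h) *
    (y i - (β 0 + β 1 * (d i).1 + β 2 * (d i).2 + β 3 * (d i).1 * (d i).2)) ^ 2

/-- `β̂`: a minimizer of the weighted sum of squares (chosen arbitrarily when the design is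
so degenerate that there are several). -/
def betaHat (K : ℝ → ℝ) (t h : ℝ) {N : ℕ} (d : Fin N → ℝ × ℝ) (y : Fin N → ℝ) : Fin 4 → ℝ :=
  Classical.epsilon fun β => ∀ β', weightedLoss K t h d y β ≤ weightedLoss K t h d y β'

/-- The local linear estimator of `τ_thresh`. -/
def tauHat (K : ℝ → ℝ) (t h : ℝ) {N : ℕ} (d : Fin N → ℝ × ℝ) (y : Fin N → ℝ) : ℝ :=
  2 * betaHat K t h d y 2 + 2 * betaHat K t h d y 3 * t

section MSE

variable {Ω : Type*} [MeasurableSpace Ω]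

/-- The design of the first `N` subjects. -/
def design (X Z : ℕ → Ω → ℝ) (N : ℕ) (ω : Ω) : Fin N → ℝ × ℝ :=
  fun i => (X i ω, Z i ω)

/-- The observed outcomes of the first `N` subjects. -/
def observed (Yp Ym Z : ℕ → Ω → ℝ) (N : ℕ) (ω : Ω) : Fin N → ℝ :=
  fun i => if Z i ω = 1 then Yp i ω else Ym i ω

/-- `MSE(h, N)`: the mean squared error of the local linear estimator with bandwidth `h` from the
first `N` subjects, conditional on their design. It is computed from the regular conditional
distribution of the observed outcomes given the design, so that it is one random function of `h`,
into which a random bandwidth can be substituted. -/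
def condMSE (P : Measure Ω) [IsFiniteMeasure P] (pop : Superpopulation) (K : ℝ → ℝ) (t : ℝ)
    (X Yp Ym Z : ℕ → Ω → ℝ) (h : ℝ) (N : ℕ) (ω : Ω) : ℝ :=
  ∫ y, (tauHat K t h (design X Z N ω) y - pop.tauThresh t) ^ 2
    ∂(condDistrib (observed Yp Ym Z N) (design X Z N) P (design X Z N ω))

end MSE

/-- The estimated optimal bandwidth of the regression discontinuity design with `N` subjects, when
`γ` is estimated by `g`. -/
def bandwidthRDD (K : ℝ → ℝ) (g : ℝ) (N : ℕ) : ℝ :=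
  (C2Tilde K / (4 * C1Tilde K)) ^ (1 / 5 : ℝ) * g * (N : ℝ) ^ (-(1 / 5) : ℝ)

/-- The estimated optimal bandwidth of the tie-breaker design with `N` subjects, when the quantity
`gammaTBD` is estimated by `g`. -/
def bandwidthTBD (K : ℝ → ℝ) (g : ℝ) (N : ℕ) : ℝ :=
  (C2 K / (4 * C1 K)) ^ (1 / 5 : ℝ) * g * (N : ℝ) ^ (-(1 / 5) : ℝ)

end TieBreaker

end

/-! Given the design, the estimator is a fixed linear function of independent outcomes, so its mean
squared error is a squared bias plus a variance. Because the treatment is 1 or -1, the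
four-parameter fit decouples into one weighted line per arm, and the estimator is the difference of
the two intercepts at `t` (`tauHat_eq_sum`). The weights of such an intercept sum to one and
annihilate linear functions. By Taylor's formula the bias of an arm is therefore about h² μ''(t)/2
times a ratio of empirical kernel moments, and its variance is about σ²(t)/(N h) times another such
ratio.

A local law of large numbers (`IsExperiment.tendsto_localAverage`, by Chebyshev) sends the empirical
moments to f(t) ∫ u^j K(u) w(u) du, where w is the probability of the arm seen at scale h around
`t`: the indicator of a half-line for the discontinuity design, a constant p or 1 - p for the
tie-breaker design. In either design the two arms share one bias constant, by reflection or by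
homogeneity, so only the gap g of the second derivatives enters the bias. At a bandwidth G N^(-1/5)
with G → a in probability, N^(4/5) MSE tends to a⁴ c₁ g² + c₂ s / (f a), which is `limitMSE`
(`IsExperiment.tendsto_condMSE`). The prescribed a is the critical point of this function; there the
variance is four times the squared bias and the value is 5 c₁ g² a⁴ (`limitMSE_optimal`). Dividing
the two values gives the constant of the theorem, and the different sample sizes contribute θ^(4/5).

The bandwidth is random and may depend on the outcomes. Two facts deal with this. The conditional
law of the outcomes is identified outside a null set that does not involve h
(`IsExperiment.condDistrib_ae_eq`), so a random h may be substituted into the exact formula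
`IsExperiment.condMSE_eq`. And the law of large numbers persists at a random bandwidth asymptotic to
a deterministic one (`IsExperiment.tendsto_localAverage_random`), by a domination argument that asks
nothing about the joint law of bandwidth and data. -/

noncomputable section

namespace TieBreaker

/-! ### Convergence in probability as convergence along a filter -/

/-- The filter on `ℕ × Ω` of the events whose probability tends to one. Convergence along it is
convergence in probability, without any measurability requirement. -/
def probFilter {Ω : Type*} [MeasurableSpace Ω] (P : Measure Ω) : Filter (ℕ × Ω) where
  sets := {S | Tendsto (fun N => P {ω | (N, ω) ∉ S}) atTop (𝓝 0)}
  univ_sets := by simp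
  sets_of_superset {S T} hS hST :=
    tendsto_of_tendsto_of_tendsto_of_le_of_le tendsto_const_nhds hS (fun _ => zero_le)
      fun N => measure_mono fun ω hω h => hω (hST h)
  inter_sets {S T} hS hT := by
    have h := Tendsto.add (Set.mem_ofPred_eq ▸ hS) (Set.mem_ofPred_eq ▸ hT)
    rw [add_zero] at h
    refine tendsto_of_tendsto_of_tendsto_of_le_of_le tendsto_const_nhds h (fun _ => zero_le)
      fun N => ?_
    refine le_trans (measure_mono ?_) (measure_union_le _ _)
    intro ω hω
    by_contra hcon
    simp only [Set.mem_union, Set.mem_ofPred_eq, not_or, not_not] at hcon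
    exact hω ⟨hcon.1, hcon.2⟩

section ProbFilter

variable {Ω : Type*} [MeasurableSpace Ω] {P : Measure Ω}

theorem eventually_probFilter_iff {p : ℕ × Ω → Prop} :
    (∀ᶠ q in probFilter P, p q) ↔ Tendsto (fun N => P {ω | ¬ p (N, ω)}) atTop (𝓝 0) :=
  Iff.rfl

/-- The gateway between the hypotheses or the goal and ordinary limits: along `probFilter` sums,
products, quotients and eventual equalities are handled by the calculus of `Tendsto`. -/
theorem tendstoInMeasure_const_iff {f : ℕ → Ω → ℝ} {c : ℝ} :
    TendstoInMeasure P f atTop (fun _ => c) ↔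
      Tendsto (fun q : ℕ × Ω => f q.1 q.2) (probFilter P) (𝓝 c) := by
  rw [tendstoInMeasure_iff_dist, Metric.tendsto_nhds]
  simp only [eventually_probFilter_iff, not_lt]

theorem tendsto_fst_probFilter : Tendsto Prod.fst (probFilter P) (atTop : Filter ℕ) := by
  rw [tendsto_atTop]
  intro b
  rw [eventually_probFilter_iff]
  refine tendsto_const_nhds.congr' ?_
  filter_upwards [eventually_ge_atTop b] with N hN
  simp [hN]

/-- Needed to pass from samples of size `N` to samples of size `m N`: null sequences of
probabilities stay null along a reindexing that tends to infinity. -/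
theorem tendsto_map_fst_probFilter {m : ℕ → ℕ} (hm : Tendsto m atTop atTop) :
    Tendsto (fun q : ℕ × Ω => (m q.1, q.2)) (probFilter P) (probFilter P) := by
  intro S hS
  exact Tendsto.comp (f := m) (g := fun N => P {ω | (N, ω) ∉ S}) hS hm

theorem eventually_probFilter_of_ae {p : ℕ × Ω → Prop} (h : ∀ N, ∀ᵐ ω ∂P, p (N, ω)) :
    ∀ᶠ q in probFilter P, p q := by
  rw [eventually_probFilter_iff]
  have : (fun N => P {ω | ¬ p (N, ω)}) = fun _ => 0 := funext fun N => ae_iff.1 (h N)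
  rw [this]
  exact tendsto_const_nhds

end ProbFilter

/-- A difference bounded by arbitrarily small multiples of a convergent quantity tends to zero. -/
theorem tendsto_of_forall_abs_sub_le {ι : Type*} {l : Filter ι} {A B C : ι → ℝ} {b c : ℝ}
    (hB : Tendsto B l (𝓝 b)) (hC : Tendsto C l (𝓝 c))
    (h : ∀ η > 0, ∀ᶠ i in l, |A i - B i| ≤ η * C i) : Tendsto A l (𝓝 b) := by
  have h0 : Tendsto (fun i => A i - B i) l (𝓝 0) := by
    rw [Metric.tendsto_nhds]
    intro ε hε
    -- The limit `c` may be zero or negative, so `|c| + 1` serves as a strictly positive eventual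
    -- bound of `C`.
    have hc : 0 < |c| + 1 := by positivity
    filter_upwards [h (ε / (|c| + 1)) (by positivity),
      hC.eventually_lt_const (lt_of_le_of_lt (le_abs_self c) (lt_add_one _))] with i h1 h2
    rw [Real.dist_eq, sub_zero]
    refine h1.trans_lt ?_
    calc ε / (|c| + 1) * C i < ε / (|c| + 1) * (|c| + 1) := by gcongr
      _ = ε := by field_simp
  simpa using h0.add hB

/-! ### Weighted least squares on a line -/

section LeastSquares

variable {ι : Type*} [Fintype ι]

/-- The weighted moment `∑ kᵢ uᵢʲ`. -/
def wMoment (k u : ι → ℝ) (j : ℕ) : ℝ := ∑ i, k i * u i ^ j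

/-- The determinant of the normal equations of a weighted least squares line. -/
def wDet (k u : ι → ℝ) : ℝ := wMoment k u 0 * wMoment k u 2 - wMoment k u 1 ^ 2

/-- The coefficients of the outcomes in the intercept of a weighted least squares line. -/
def interceptWeight (k u : ι → ℝ) (i : ι) : ℝ :=
  k i * (wMoment k u 2 - wMoment k u 1 * u i) / wDet k u

/-- The powers 0 and 1 say that the intercept reproduces constants and ignores slopes; the power 2
is the factor of the second derivative in the bias. -/
theorem sum_interceptWeight_mul_pow (k u : ι → ℝ) (j : ℕ) :
    ∑ i, interceptWeight k u i * u i ^ j =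
      (wMoment k u 2 * wMoment k u j - wMoment k u 1 * wMoment k u (j + 1)) / wDet k u := by
  simp only [interceptWeight, div_mul_eq_mul_div]
  rw [← Finset.sum_div]
  congr 1
  rw [wMoment.eq_1 k u j, wMoment.eq_1 k u (j + 1), Finset.mul_sum, Finset.mul_sum,
    ← Finset.sum_sub_distrib]
  exact Finset.sum_congr rfl fun i _ => by ring

theorem sum_interceptWeight {k u : ι → ℝ} (hd : wDet k u ≠ 0) :
    ∑ i, interceptWeight k u i = 1 := by
  have h := sum_interceptWeight_mul_pow k u 0
  simp only [pow_zero, mul_one, zero_add] at h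
  rw [h, div_eq_one_iff_eq hd, wDet]
  ring

theorem sum_interceptWeight_mul {k u : ι → ℝ} : ∑ i, interceptWeight k u i * u i = 0 := by
  have h := sum_interceptWeight_mul_pow k u 1
  simp only [pow_one] at h
  rw [h]
  ring

/-- Pythagoras for the weighted inner product: the residuals of the solution of the normal equations
are orthogonal to 1 and to `u`. The slope stays existential because only the intercept enters the
estimator. -/
theorem exists_leastSquares {k u y : ι → ℝ} (hd : wDet k u ≠ 0) :
    ∃ b : ℝ, ∀ a' b' : ℝ, ∑ i, k i * (y i - (a' + b' * u i)) ^ 2 =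
      ∑ i, k i * (y i - (∑ j, interceptWeight k u j * y j + b * u i)) ^ 2 +
      ∑ i, k i * ((a' - ∑ j, interceptWeight k u j * y j) + (b' - b) * u i) ^ 2 := by
  set s0 := ∑ i, k i with hs0
  set s1 := ∑ i, k i * u i with hs1
  set s2 := ∑ i, k i * u i ^ 2 with hs2
  set q0 := ∑ i, k i * y i with hq0
  set q1 := ∑ i, k i * u i * y i with hq1
  have hD : wDet k u = s0 * s2 - s1 ^ 2 := by simp [wDet, wMoment, hs0, hs1, hs2]
  have ha : ∑ j, interceptWeight k u j * y j = (s2 * q0 - s1 * q1) / (s0 * s2 - s1 ^ 2) := by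
    rw [← hD, hq0, hq1, Finset.mul_sum, Finset.mul_sum, ← Finset.sum_sub_distrib, Finset.sum_div]
    refine Finset.sum_congr rfl fun i _ => ?_
    simp only [interceptWeight, wMoment, pow_one, ← hs1, ← hs2]
    ring
  rw [hD] at hd
  rw [ha]
  set a := (s2 * q0 - s1 * q1) / (s0 * s2 - s1 ^ 2) with haa
  refine ⟨(s0 * q1 - s1 * q0) / (s0 * s2 - s1 ^ 2), fun a' b' => ?_⟩
  set b := (s0 * q1 - s1 * q0) / (s0 * s2 - s1 ^ 2) with hb
  -- Cramer's rule for the two normal equations, with denominators cleared; `n0` and `n1` check the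
  -- equations after multiplication by the determinant.
  have ha' : a * (s0 * s2 - s1 ^ 2) = s2 * q0 - s1 * q1 := div_mul_cancel₀ _ hd
  have hb' : b * (s0 * s2 - s1 ^ 2) = s0 * q1 - s1 * q0 := div_mul_cancel₀ _ hd
  have n0 : ∑ i, k i * (y i - (a + b * u i)) = 0 := by
    have : ∑ i, k i * (y i - (a + b * u i)) = q0 - (a * s0 + b * s1) := by
      rw [hq0, hs0, hs1, Finset.mul_sum, Finset.mul_sum, ← Finset.sum_add_distrib,
        ← Finset.sum_sub_distrib]
      exact Finset.sum_congr rfl fun i _ => by ring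
    rw [this]
    apply mul_right_cancel₀ hd
    linear_combination (-s0) * ha' - s1 * hb'
  have n1 : ∑ i, k i * u i * (y i - (a + b * u i)) = 0 := by
    have : ∑ i, k i * u i * (y i - (a + b * u i)) = q1 - (a * s1 + b * s2) := by
      rw [hq1, hs1, hs2, Finset.mul_sum, Finset.mul_sum, ← Finset.sum_add_distrib,
        ← Finset.sum_sub_distrib]
      exact Finset.sum_congr rfl fun i _ => by ring
    rw [this]
    apply mul_right_cancel₀ hd
    linear_combination (-s1) * ha' - s2 * hb'
  have key : ∑ i, k i * (y i - (a' + b' * u i)) ^ 2 =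
      ∑ i, k i * (y i - (a + b * u i)) ^ 2 + ∑ i, k i * ((a' - a) + (b' - b) * u i) ^ 2
      - 2 * (a' - a) * ∑ i, k i * (y i - (a + b * u i))
      - 2 * (b' - b) * ∑ i, k i * u i * (y i - (a + b * u i)) := by
    rw [Finset.mul_sum, Finset.mul_sum, ← Finset.sum_add_distrib, ← Finset.sum_sub_distrib,
      ← Finset.sum_sub_distrib]
    exact Finset.sum_congr rfl fun i _ => by ring
  rw [key, n0, n1]
  ring

/-- Uniqueness of the intercept. With moments s₀, s₁, s₂, completing the square gives s₂ (c² s₀ + 2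
c d s₁ + d² s₂) = det · c² + (s₂ d + s₁ c)². -/
theorem eq_zero_of_sum_mul_sq_le_zero {k u : ι → ℝ} {c d : ℝ} (hk : ∀ i, 0 ≤ k i)
    (hd : 0 < wDet k u) (h : ∑ i, k i * (c + d * u i) ^ 2 ≤ 0) : c = 0 := by
  have hs2 : 0 ≤ wMoment k u 2 := Finset.sum_nonneg fun i _ => mul_nonneg (hk i) (sq_nonneg _)
  have e : ∑ i, k i * (c + d * u i) ^ 2 =
      c ^ 2 * wMoment k u 0 + 2 * c * d * wMoment k u 1 + d ^ 2 * wMoment k u 2 := by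
    simp only [wMoment, Finset.mul_sum, ← Finset.sum_add_distrib]
    exact Finset.sum_congr rfl fun i _ => by ring
  rw [e] at h
  have h1 : wDet k u * c ^ 2 ≤ 0 := by
    have := mul_nonpos_of_nonneg_of_nonpos hs2 h
    rw [wDet]
    nlinarith [sq_nonneg (wMoment k u 2 * d + wMoment k u 1 * c)]
  have h2 : c ^ 2 ≤ 0 := by
    by_contra hc
    push Not at hc
    have := mul_pos hd hc
    linarith
  exact pow_eq_zero_iff two_ne_zero |>.1 (le_antisymm h2 (sq_nonneg c))

end LeastSquares

/-! ### The estimator as a difference of intercepts -/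

section Estimator

variable {N : ℕ}

/-- The kernel weights of the subjects of one arm of the experiment, the treated ones for
`b = true` and the controls for `b = false`. -/
def armWeight (K : ℝ → ℝ) (t h : ℝ) (d : Fin N → ℝ × ℝ) (b : Bool) (i : Fin N) : ℝ :=
  if (d i).2 = 1 ↔ b then K (((d i).1 - t) / h) else 0

/-- The assignment variables, centred and rescaled. -/
def scaled (t h : ℝ) (d : Fin N → ℝ × ℝ) (i : Fin N) : ℝ := ((d i).1 - t) / h

/-- The coefficients of the outcomes in the estimator. -/
def tauWeight (K : ℝ → ℝ) (t h : ℝ) (d : Fin N → ℝ × ℝ) (i : Fin N) : ℝ :=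
  interceptWeight (armWeight K t h d true) (scaled t h d) i -
    interceptWeight (armWeight K t h d false) (scaled t h d) i

/-- On the treated and on the control subjects the regression function is a line of its own, and the
reparametrization is bijective. Centring at `t` makes 2β₃ + 2β₄t exactly the difference of the
intercepts, which is unique when both determinants are positive; so the arbitrary choice in
`betaHat` is harmless. -/
theorem tauHat_eq_sum {K : ℝ → ℝ} (hK : ∀ u, 0 ≤ K u) {t h : ℝ} (hh : h ≠ 0)
    {d : Fin N → ℝ × ℝ} (hd : ∀ i, (d i).2 = 1 ∨ (d i).2 = -1)
    (hp : 0 < wDet (armWeight K t h d true) (scaled t h d))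
    (hm : 0 < wDet (armWeight K t h d false) (scaled t h d)) (y : Fin N → ℝ) :
    tauHat K t h d y = ∑ i, tauWeight K t h d i * y i := by
  set u := scaled t h d with hu
  set kp := armWeight K t h d true with hkp
  set km := armWeight K t h d false with hkm
  have kp0 : ∀ i, 0 ≤ kp i := fun i => by
    simp only [hkp, armWeight]; split_ifs <;> simp [hK]
  have km0 : ∀ i, 0 ≤ km i := fun i => by
    simp only [hkm, armWeight]; split_ifs <;> simp [hK]
  obtain ⟨bp, hbp⟩ := exists_leastSquares (y := y) hp.ne'
  obtain ⟨bm, hbm⟩ := exists_leastSquares (y := y) hm.ne'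
  set ap := ∑ j, interceptWeight kp u j * y j with hap
  set am := ∑ j, interceptWeight km u j * y j with ham
  have loss : ∀ β : Fin 4 → ℝ, weightedLoss K t h d y β =
      ∑ i, kp i * (y i - (((β 0 + β 2) + (β 1 + β 3) * t) + ((β 1 + β 3) * h) * u i)) ^ 2 +
      ∑ i, km i * (y i - (((β 0 - β 2) + (β 1 - β 3) * t) + ((β 1 - β 3) * h) * u i)) ^ 2 := by
    intro β
    rw [weightedLoss, ← Finset.sum_add_distrib]
    refine Finset.sum_congr rfl fun i _ => ?_
    have hx : h * u i = (d i).1 - t := by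
      simp only [hu, scaled]; field_simp
    rw [mul_assoc _ h, mul_assoc _ h, hx]
    rcases hd i with hz | hz
    · simp only [hkp, hkm, armWeight, hz, Bool.false_eq_true, iff_false,
        not_true_eq_false, if_true, if_false, zero_mul, add_zero]
      ring
    · have : ¬ ((-1 : ℝ) = 1) := by norm_num
      simp only [hkp, hkm, armWeight, hz, this, iff_true, Bool.false_eq_true, if_true, if_false, zero_mul, zero_add]
      ring
  have nn : ∀ {k : Fin N → ℝ} (_ : ∀ i, 0 ≤ k i) (c e : ℝ),
      0 ≤ ∑ i, k i * (c + e * u i) ^ 2 := fun hk c e =>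
    Finset.sum_nonneg fun i _ => mul_nonneg (hk i) (sq_nonneg _)
  -- The separately fitted lines, translated back to the four original coefficients.
  let βs : Fin 4 → ℝ := ![(ap - bp / h * t + (am - bm / h * t)) / 2, (bp / h + bm / h) / 2,
    (ap - bp / h * t - (am - bm / h * t)) / 2, (bp / h - bm / h) / 2]
  have hβs : weightedLoss K t h d y βs =
      ∑ i, kp i * (y i - (ap + bp * u i)) ^ 2 + ∑ i, km i * (y i - (am + bm * u i)) ^ 2 := by
    rw [loss]
    have e1 : βs 0 + βs 2 + (βs 1 + βs 3) * t = ap := by simp [βs]; ring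
    have e2 : (βs 1 + βs 3) * h = bp := by simp [βs]; field_simp; ring
    have e3 : βs 0 - βs 2 + (βs 1 - βs 3) * t = am := by simp [βs]; ring
    have e4 : (βs 1 - βs 3) * h = bm := by simp [βs]; field_simp; ring
    rw [e1, e2, e3, e4]
  have hex : ∃ β, ∀ β', weightedLoss K t h d y β ≤ weightedLoss K t h d y β' := by
    refine ⟨βs, fun β' => ?_⟩
    rw [hβs, loss β', hbp (_ + _ + _), hbm (_ - _ + _)]
    linarith [nn kp0 (β' 0 + β' 2 + (β' 1 + β' 3) * t - ap) ((β' 1 + β' 3) * h - bp),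
      nn km0 (β' 0 - β' 2 + (β' 1 - β' 3) * t - am) ((β' 1 - β' 3) * h - bm)]
  -- The chosen minimizer is no worse than `βs`, so the nonnegative excess losses of the two arms
  -- sum to at most zero and each of them vanishes.
  have hmin := Classical.epsilon_spec hex βs
  change weightedLoss K t h d y (betaHat K t h d y) ≤ _ at hmin
  rw [tauHat]
  set β := betaHat K t h d y
  rw [hβs, loss β, hbp (_ + _ + _), hbm (_ - _ + _)] at hmin
  have h1 := nn kp0 (β 0 + β 2 + (β 1 + β 3) * t - ap) ((β 1 + β 3) * h - bp)
  have h2 := nn km0 (β 0 - β 2 + (β 1 - β 3) * t - am) ((β 1 - β 3) * h - bm)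
  have c1 := eq_zero_of_sum_mul_sq_le_zero kp0 hp (c := β 0 + β 2 + (β 1 + β 3) * t - ap)
    (d := (β 1 + β 3) * h - bp) (by linarith)
  have c2 := eq_zero_of_sum_mul_sq_le_zero km0 hm (c := β 0 - β 2 + (β 1 - β 3) * t - am)
    (d := (β 1 - β 3) * h - bm) (by linarith)
  have : ∑ i, tauWeight K t h d i * y i = ap - am := by
    simp only [tauWeight, sub_mul, Finset.sum_sub_distrib, hap, ham, hu, hkp, hkm]
  rw [this]
  linarith

end Estimator

/-! ### The conditional distribution of the outcomes given the design -/

/-- The probability of being assigned to an arm of the experiment. -/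
def armProb (e : ℝ → ℝ) (b : Bool) (x : ℝ) : ℝ := if b then e x else 1 - e x

/-- The potential outcome of an arm of the experiment. -/
def armOutcome (b : Bool) (y : ℝ × ℝ) : ℝ := if b then y.1 else y.2

/-- The conditional mean of the potential outcome of an arm. -/
def armMean (pop : Superpopulation) (b : Bool) (x : ℝ) : ℝ :=
  if b then pop.meanPlus x else pop.meanMinus x

/-- The conditional variance of the potential outcome of an arm. -/
def armVar (pop : Superpopulation) (b : Bool) (x : ℝ) : ℝ :=
  if b then pop.varPlus x else pop.varMinus x

theorem measurable_armOutcome (b : Bool) : Measurable (armOutcome b) := by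
  cases b
  · exact measurable_snd
  · exact measurable_fst

theorem armMean_eq (pop : Superpopulation) (b : Bool) (x : ℝ) :
    armMean pop b x = ∫ y, armOutcome b y ∂(pop.cond x) := by
  cases b <;> rfl

theorem armVar_eq (pop : Superpopulation) (b : Bool) (x : ℝ) :
    armVar pop b x = variance (armOutcome b) (pop.cond x) := by
  cases b <;> rfl

instance (pop : Superpopulation) : IsMarkovKernel pop.cond := pop.markov_cond

theorem lintegral_law (pop : Superpopulation) {g : ℝ × (ℝ × ℝ) → ENNReal} (hg : Measurable g) :
    ∫⁻ w, g w ∂pop.law =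
      ∫⁻ x, ENNReal.ofReal (pop.density x) * ∫⁻ y, g (x, y) ∂(pop.cond x) := by
  rw [Superpopulation.law, Measure.lintegral_compProd hg,
    lintegral_withDensity_eq_lintegral_mul _ pop.measurable_density.ennreal_ofReal
      hg.lintegral_kernel_prod_right']
  rfl

theorem indicator_eq_indicator_of_mem_iff {α β γ : Type*} [Zero γ] {s : Set α} {t : Set β}
    {f : α → γ} {g : β → γ} {a : α} {b : β} (h : a ∈ s ↔ b ∈ t) (hfg : f a = g b) :
    s.indicator f a = t.indicator g b := by
  by_cases ha : a ∈ s
  · rw [Set.indicator_of_mem ha, Set.indicator_of_mem (h.1 ha), hfg]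
  · rw [Set.indicator_of_notMem ha, Set.indicator_of_notMem (fun hb => ha (h.2 hb))]

section Experiment

variable {Ω : Type*} [MeasurableSpace Ω] {P : Measure Ω}
  {pop : Superpopulation} {e : ℝ → ℝ} {X Yp Ym Z : ℕ → Ω → ℝ}

theorem IsExperiment.measurableSet_arm (hE : IsExperiment P pop e X Yp Ym Z) (b : Bool) (i : ℕ) :
    MeasurableSet {ω | Z i ω = 1 ↔ b} := by
  have h : MeasurableSet {ω | Z i ω = 1} := hE.measurable_Z i (measurableSet_singleton 1)
  cases b
  · have e : {ω | Z i ω = 1 ↔ (false = true)} = {ω | Z i ω = 1}ᶜ := by ext ω; simp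
    rw [e]
    exact h.compl
  · simpa using! h

theorem IsExperiment.measurable_triple (hE : IsExperiment P pop e X Yp Ym Z) (i : ℕ) :
    Measurable fun ω => (X i ω, (Yp i ω, Ym i ω)) :=
  (hE.measurable_X i).prodMk ((hE.measurable_Yp i).prodMk (hE.measurable_Ym i))

/-- The law of the triple of a subject, on the event that the subject is in a given arm. -/
theorem IsExperiment.map_restrict_arm [IsProbabilityMeasure P] (hE : IsExperiment P pop e X Yp Ym Z) (he : Measurable e)
    (he0 : ∀ x, 0 ≤ e x) (he1 : ∀ x, e x ≤ 1) (b : Bool) (i : ℕ) :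
    (P.restrict {ω | Z i ω = 1 ↔ b}).map (fun ω => (X i ω, (Yp i ω, Ym i ω))) =
      pop.law.withDensity fun w => ENNReal.ofReal (armProb e b w.1) := by
  have hW := hE.measurable_triple i
  have hZ : MeasurableSet {ω | Z i ω = 1} := hE.measurable_Z i (measurableSet_singleton 1)
  have hX := hE.measurable_X i
  have he' : Measurable fun w : ℝ × (ℝ × ℝ) => ENNReal.ofReal (e w.1) :=
    (he.comp measurable_fst).ennreal_ofReal
  have heX : Integrable (fun ω => e (X i ω)) P :=
    Integrable.of_bound (he.comp hX).aestronglyMeasurable 1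
      (ae_of_all _ fun ω => by rw [Real.norm_of_nonneg (he0 _)]; exact he1 _)
  have hl : ∀ {g : ℝ × (ℝ × ℝ) → ENNReal}, Measurable g → ∀ {A}, MeasurableSet A →
      ∫⁻ w in A, g w ∂pop.law =
        ∫⁻ ω in (fun ω => (X i ω, (Yp i ω, Ym i ω))) ⁻¹' A, g (X i ω, (Yp i ω, Ym i ω)) ∂P := by
    intro g hg A hA
    rw [← hE.law i, setLIntegral_map hA hg hW]
  -- The defining property of the conditional expectation in `assignment`, tested on the events
  -- generated by the triple.
  have htrue : ∀ {A : Set (ℝ × (ℝ × ℝ))}, MeasurableSet A →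
      P ((fun ω => (X i ω, (Yp i ω, Ym i ω))) ⁻¹' A ∩ {ω | Z i ω = 1}) =
        ∫⁻ w in A, ENNReal.ofReal (e w.1) ∂pop.law := by
    intro A hA
    have hintg : Integrable (Set.indicator {ω | Z i ω = 1} (fun _ => (1 : ℝ))) P :=
      (integrable_const _).indicator hZ
    have h1 := setIntegral_condExp hW.comap_le hintg (s := (fun ω => (X i ω, (Yp i ω, Ym i ω))) ⁻¹' A)
      ⟨A, hA, rfl⟩
    rw [setIntegral_congr_ae (hW hA) ((hE.assignment i).mono fun ω h _ => h)] at h1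
    rw [setIntegral_indicator hZ, setIntegral_const, smul_eq_mul, mul_one] at h1
    rw [hl he' hA,
      ← ofReal_integral_eq_lintegral_ofReal heX.integrableOn (ae_of_all _ fun ω => he0 _), h1,
      ofReal_measureReal]
  ext A hA
  rw [Measure.map_apply hW hA, Measure.restrict_apply (hW hA), withDensity_apply _ hA]
  cases b
  -- The control arm is the complement of the treated one; its measure follows by cancelling the
  -- treated part, which is finite.
  · have h2 : P ((fun ω => (X i ω, (Yp i ω, Ym i ω))) ⁻¹' A) =
        ∫⁻ w in A, ENNReal.ofReal (e w.1) ∂pop.law +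
          ∫⁻ w in A, ENNReal.ofReal (1 - e w.1) ∂pop.law := by
      rw [← lintegral_add_left he']
      have : ∀ w : ℝ × (ℝ × ℝ), ENNReal.ofReal (e w.1) + ENNReal.ofReal (1 - e w.1) = 1 := by
        intro w
        rw [← ENNReal.ofReal_add (he0 _) (sub_nonneg.2 (he1 _))]
        simp
      simp only [this]
      rw [setLIntegral_one, ← hE.law i, Measure.map_apply hW hA]
    have h3 := measure_inter_add_sdiff (μ := P) ((fun ω => (X i ω, (Yp i ω, Ym i ω))) ⁻¹' A) hZ
    rw [h2, htrue hA] at h3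
    have hfin : ∫⁻ w in A, ENNReal.ofReal (e w.1) ∂pop.law ≠ ⊤ := by
      rw [← htrue hA]
      exact measure_ne_top _ _
    have h4 := (ENNReal.add_right_inj hfin).1 h3
    simpa [armProb, Set.sdiff_eq, Set.compl_def] using! h4
  · simpa [armProb] using htrue hA

/-- The factor `armProb e b x` stands outside the integral over the potential outcomes because the
randomization looks only at `x`. All one-subject computations below reduce to this formula. -/
theorem IsExperiment.setLIntegral_arm [IsProbabilityMeasure P] (hE : IsExperiment P pop e X Yp Ym Z) (he : Measurable e)
    (he0 : ∀ x, 0 ≤ e x) (he1 : ∀ x, e x ≤ 1) (b : Bool) (i : ℕ)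
    {g : ℝ × (ℝ × ℝ) → ENNReal} (hg : Measurable g) :
    ∫⁻ ω in {ω | Z i ω = 1 ↔ b}, g (X i ω, (Yp i ω, Ym i ω)) ∂P =
      ∫⁻ x, ENNReal.ofReal (pop.density x) *
        (ENNReal.ofReal (armProb e b x) * ∫⁻ y, g (x, y) ∂(pop.cond x)) := by
  have hb : Measurable fun w : ℝ × (ℝ × ℝ) => ENNReal.ofReal (armProb e b w.1) := by
    cases b
    · simpa [armProb] using! (measurable_const.sub (he.comp measurable_fst)).ennreal_ofReal
    · simpa [armProb] using! (he.comp measurable_fst).ennreal_ofReal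
  rw [← lintegral_map hg (hE.measurable_triple i), hE.map_restrict_arm he he0 he1,
    lintegral_withDensity_eq_lintegral_mul _ hb hg, lintegral_law pop (hb.mul hg)]
  congr 1
  ext x
  congr 1
  simp only [Pi.mul_apply]
  exact lintegral_const_mul _ (hg.comp measurable_prodMk_left)

/-- The conditional law of the potential outcome of an arm given the design point. -/
def armKernel (pop : Superpopulation) (b : Bool) : Kernel (ℝ × ℝ) ℝ :=
  Kernel.map (Kernel.comap pop.cond Prod.fst measurable_fst : Kernel (ℝ × ℝ) (ℝ × ℝ)) (armOutcome b)

instance (pop : Superpopulation) (b : Bool) : IsMarkovKernel (armKernel pop b) :=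
  Kernel.IsMarkovKernel.map _ (measurable_armOutcome b)

theorem armKernel_apply (pop : Superpopulation) (b : Bool) (d : ℝ × ℝ) :
    armKernel pop b d = (pop.cond d.1).map (armOutcome b) := by
  rw [armKernel, Kernel.map_apply _ (measurable_armOutcome b), Kernel.comap_apply]

open Classical in
/-- The conditional law of the observed outcome of a subject given its design point. -/
def outcomeKernel (pop : Superpopulation) : Kernel (ℝ × ℝ) ℝ :=
  Kernel.piecewise (s := (Prod.snd : ℝ × ℝ → ℝ) ⁻¹' {1}) (measurable_snd (measurableSet_singleton 1))
    (armKernel pop true) (armKernel pop false)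

instance (pop : Superpopulation) : IsMarkovKernel (outcomeKernel pop) := by
  rw [outcomeKernel]
  infer_instance

theorem outcomeKernel_apply (pop : Superpopulation) {d : ℝ × ℝ} {b : Bool} (hd : d.2 = 1 ↔ b) :
    outcomeKernel pop d = (pop.cond d.1).map (armOutcome b) := by
  classical
  rw [outcomeKernel, Kernel.piecewise_apply]
  cases b
  · have : ¬ d ∈ (Prod.snd : ℝ × ℝ → ℝ) ⁻¹' {1} := by simpa using hd
    rw [if_neg this, armKernel_apply]
  · have : d ∈ (Prod.snd : ℝ × ℝ → ℝ) ⁻¹' {1} := by simpa using hd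
    rw [if_pos this, armKernel_apply]

/-- The observed outcome of a subject. -/
def outcome (Yp Ym Z : ℕ → Ω → ℝ) (i : ℕ) (ω : Ω) : ℝ := if Z i ω = 1 then Yp i ω else Ym i ω

theorem IsExperiment.measurable_outcome (hE : IsExperiment P pop e X Yp Ym Z) (i : ℕ) :
    Measurable (outcome Yp Ym Z i) :=
  Measurable.ite (hE.measurable_Z i (measurableSet_singleton 1)) (hE.measurable_Yp i)
    (hE.measurable_Ym i)

theorem IsExperiment.measurable_point (hE : IsExperiment P pop e X Yp Ym Z) (i : ℕ) :
    Measurable fun ω => (X i ω, Z i ω) :=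
  (hE.measurable_X i).prodMk (hE.measurable_Z i)

/-- Given the assignment variable, the treatment carries no information on the potential outcomes.
Hence, given the design point, the observed outcome has the conditional law of the potential outcome
of its arm. Rectangles suffice. -/
theorem IsExperiment.map_point_outcome [IsProbabilityMeasure P] (hE : IsExperiment P pop e X Yp Ym Z) (he : Measurable e)
    (he0 : ∀ x, 0 ≤ e x) (he1 : ∀ x, e x ≤ 1) (i : ℕ) :
    P.map (fun ω => ((X i ω, Z i ω), outcome Yp Ym Z i ω)) =
      P.map (fun ω => (X i ω, Z i ω)) ⊗ₘ outcomeKernel pop := by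
  have hD := hE.measurable_point i
  have hY := hE.measurable_outcome i
  have hprob : IsProbabilityMeasure (P.map fun ω => (X i ω, Z i ω)) :=
    Measure.isProbabilityMeasure_map hD.aemeasurable
  refine Measure.ext_prod fun {A B} hA hB => ?_
  rw [Measure.map_apply (hD.prodMk hY) (hA.prod hB), Measure.compProd_apply_prod hA hB,
    setLIntegral_map hA ((outcomeKernel pop).measurable_coe hB) hD]
  set z : Bool → ℝ := fun b => if b then 1 else -1 with hz
  have hZz : ∀ (b : Bool) (ω), ω ∈ {ω | Z i ω = 1 ↔ b} → Z i ω = z b := by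
    intro b ω hω
    cases b
    · have hω' : ¬ Z i ω = 1 := by simpa using hω
      simpa [hz] using (hE.treatment i ω).resolve_left hω'
    · simpa [hz] using hω
  have hzb : ∀ b, z b = 1 ↔ b = true := by
    intro b
    cases b
    · simp only [hz, Bool.false_eq_true, if_false, iff_false]; norm_num
    · simp [hz]
  have hsplit : ∀ g : Ω → ENNReal, ∫⁻ ω, g ω ∂P =
      ∫⁻ ω in {ω | Z i ω = 1 ↔ true}, g ω ∂P + ∫⁻ ω in {ω | Z i ω = 1 ↔ false}, g ω ∂P := by
    intro g
    rw [← lintegral_add_compl g (hE.measurableSet_arm true i)]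
    congr 3
    ext ω
    simp
  rw [← lintegral_indicator_one ((hD.prodMk hY) (hA.prod hB)), ← lintegral_indicator (hD hA),
    hsplit, hsplit]
  -- On a single arm the treatment is the constant `z b`, so both integrands are functions of the
  -- triple alone and `setLIntegral_arm` applies to each.
  have harm : ∀ b : Bool,
      ∫⁻ ω in {ω | Z i ω = 1 ↔ b}, ((fun ω => ((X i ω, Z i ω), outcome Yp Ym Z i ω)) ⁻¹'
        A ×ˢ B).indicator 1 ω ∂P =
      ∫⁻ ω in {ω | Z i ω = 1 ↔ b}, ((fun ω => (X i ω, Z i ω)) ⁻¹' A).indicator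
        (fun ω => outcomeKernel pop (X i ω, Z i ω) B) ω ∂P := by
    intro b
    have hm : Measurable fun x : ℝ => (x, z b) := measurable_id.prodMk measurable_const
    have hA' : MeasurableSet ((fun x : ℝ => (x, z b)) ⁻¹' A) := hm hA
    have hB' : MeasurableSet (armOutcome b ⁻¹' B) := measurable_armOutcome b hB
    have e1 := hE.setLIntegral_arm he he0 he1 b i
      (g := (((fun x : ℝ => (x, z b)) ⁻¹' A) ×ˢ (armOutcome b ⁻¹' B)).indicator 1)
      (measurable_one.indicator (hA'.prod hB'))
    have e2 := hE.setLIntegral_arm he he0 he1 b i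
      (g := fun w => ((fun x : ℝ => (x, z b)) ⁻¹' A).indicator
        (fun x => outcomeKernel pop (x, z b) B) w.1)
      (((((outcomeKernel pop).measurable_coe hB).comp hm).indicator hA').comp measurable_fst)
    have l1 := setLIntegral_congr_fun (μ := P) (hE.measurableSet_arm b i)
      (f := ((fun ω => ((X i ω, Z i ω), outcome Yp Ym Z i ω)) ⁻¹' A ×ˢ B).indicator 1)
      (g := fun ω => (((fun x : ℝ => (x, z b)) ⁻¹' A) ×ˢ (armOutcome b ⁻¹' B)).indicator
        (1 : ℝ × (ℝ × ℝ) → ENNReal) (X i ω, (Yp i ω, Ym i ω))) (fun ω hω => by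
          have h1 : outcome Yp Ym Z i ω = armOutcome b (Yp i ω, Ym i ω) := by
            have : (Z i ω = 1 ↔ b = true) := hω
            simp only [outcome, armOutcome, this]
          refine indicator_eq_indicator_of_mem_iff ?_ rfl
          simp only [Set.mem_preimage, Set.mem_prod, hZz b ω hω, h1])
    have l2 := setLIntegral_congr_fun (μ := P) (hE.measurableSet_arm b i)
      (f := ((fun ω => (X i ω, Z i ω)) ⁻¹' A).indicator
        (fun ω => outcomeKernel pop (X i ω, Z i ω) B))
      (g := fun ω => ((fun x : ℝ => (x, z b)) ⁻¹' A).indicator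
        (fun x => outcomeKernel pop (x, z b) B) (X i ω)) (fun ω hω => by
          refine indicator_eq_indicator_of_mem_iff ?_ ?_ <;>
            simp only [Set.mem_preimage, hZz b ω hω])
    rw [l1, l2, e1, e2]
    congr 1
    ext x
    congr 2
    rw [show (fun y : ℝ × ℝ => ((fun x : ℝ => (x, z b)) ⁻¹' A).indicator
        (fun x => outcomeKernel pop (x, z b) B) (x, y).1) = fun _ =>
        ((fun x : ℝ => (x, z b)) ⁻¹' A).indicator (fun x => outcomeKernel pop (x, z b) B) x from rfl,
      MeasureTheory.lintegral_const, measure_univ, mul_one]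
    by_cases hx : (x, z b) ∈ A
    · rw [Set.indicator_of_mem (show x ∈ (fun x : ℝ => (x, z b)) ⁻¹' A from hx),
        outcomeKernel_apply pop (d := (x, z b)) (hzb b),
        Measure.map_apply (measurable_armOutcome b) hB, ← lintegral_indicator_one hB']
      congr 1
      ext y
      exact indicator_eq_indicator_of_mem_iff (by simp [hx]) rfl
    · rw [Set.indicator_of_notMem (show ¬ x ∈ (fun x : ℝ => (x, z b)) ⁻¹' A from hx)]
      simp [Set.indicator, hx]
  rw [harm true, harm false]

end Experiment

/-! ### Finite products of a Markov kernel -/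

section ProductKernel

variable {α β ι : Type*} [MeasurableSpace α] [MeasurableSpace β] [Fintype ι]

/-- The product of the laws of a Markov kernel at finitely many points. -/
def piKernel (κ : Kernel α β) [IsMarkovKernel κ] : Kernel (ι → α) (ι → β) where
  toFun d := Measure.pi fun i => κ (d i)
  measurable' := by
    refine Measurable.measure_of_isPiSystem_of_isProbabilityMeasure generateFrom_pi.symm
      isPiSystem_pi ?_
    rintro _ ⟨s, hs, rfl⟩
    simp only [Measure.pi_pi]
    refine Finset.measurable_prod _ fun i _ => ?_
    exact (κ.measurable_coe (hs i (Set.mem_univ i))).comp (measurable_pi_apply i)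

theorem piKernel_apply (κ : Kernel α β) [IsMarkovKernel κ] (d : ι → α) :
    piKernel κ d = Measure.pi fun i => κ (d i) := rfl

instance (κ : Kernel α β) [IsMarkovKernel κ] : IsMarkovKernel (piKernel (ι := ι) κ) :=
  ⟨fun d => by rw [piKernel_apply]; infer_instance⟩

/-- On boxes the inner product measure factorizes for fixed `d`, and the outer integral of that
product factorizes because the coordinates are independent. -/
theorem map_pi_compProd_piKernel (ν : Measure α) [IsProbabilityMeasure ν] (κ : Kernel α β)
    [IsMarkovKernel κ] :
    ((Measure.pi fun _ : ι => ν) ⊗ₘ piKernel κ).map (MeasurableEquiv.arrowProdEquivProdArrow α β ι).symm =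
      Measure.pi fun _ => ν ⊗ₘ κ := by
  symm
  refine Measure.pi_eq fun s hs => ?_
  have hpre : ∀ d : ι → α, Prod.mk d ⁻¹'
      ((MeasurableEquiv.arrowProdEquivProdArrow α β ι).symm ⁻¹' Set.univ.pi s) =
      Set.univ.pi fun i => Prod.mk (d i) ⁻¹' s i := by
    intro d
    ext y
    simp only [Set.mem_preimage, Set.mem_univ_pi]
    rfl
  have hg : ∀ i, Measurable fun a => κ a (Prod.mk a ⁻¹' s i) := fun i =>
    Kernel.measurable_kernel_prodMk_left (hs i)
  rw [MeasurableEquiv.map_apply, Measure.compProd_apply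
    ((MeasurableEquiv.measurable _) (MeasurableSet.univ_pi hs))]
  simp only [hpre, piKernel_apply, Measure.pi_pi]
  have hind : iIndepFun (fun i (d : ι → α) => κ (d i) (Prod.mk (d i) ⁻¹' s i))
      (Measure.pi fun _ => ν) :=
    iIndepFun_pi (X := fun i a => κ a (Prod.mk a ⁻¹' s i)) fun i => (hg i).aemeasurable
  rw [lintegral_prod_eq_prod_lintegral_of_indepFun Finset.univ _ hind
    fun i => (hg i).comp (measurable_pi_apply i)]
  refine Finset.prod_congr rfl fun i _ => ?_
  rw [Measure.compProd_apply (hs i),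
    ← (measurePreserving_eval (fun _ : ι => ν) i).lintegral_comp (hg i)]

end ProductKernel

section Experiment

variable {Ω : Type*} [MeasurableSpace Ω] {P : Measure Ω} [IsProbabilityMeasure P]
  {pop : Superpopulation} {e : ℝ → ℝ} {X Yp Ym Z : ℕ → Ω → ℝ}

/-- The conditional joint law of the treatment of a subject does not depend on the subject. -/
theorem IsExperiment.map_point_eq (hE : IsExperiment P pop e X Yp Ym Z) (he : Measurable e)
    (he0 : ∀ x, 0 ≤ e x) (he1 : ∀ x, e x ≤ 1) (i : ℕ) :
    P.map (fun ω => (X i ω, Z i ω)) = P.map (fun ω => (X 0 ω, Z 0 ω)) := by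
  have hsplit : ∀ i, ∀ A : Set (ℝ × ℝ), MeasurableSet A → P.map (fun ω => (X i ω, Z i ω)) A =
      (∫⁻ x, ENNReal.ofReal (pop.density x) * (ENNReal.ofReal (armProb e true x) *
        ∫⁻ _, A.indicator 1 (x, (1 : ℝ)) ∂(pop.cond x))) +
      ∫⁻ x, ENNReal.ofReal (pop.density x) * (ENNReal.ofReal (armProb e false x) *
        ∫⁻ _, A.indicator 1 (x, (-1 : ℝ)) ∂(pop.cond x)) := by
    intro i A hA
    have hg : ∀ z : ℝ, Measurable fun w : ℝ × (ℝ × ℝ) =>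
        A.indicator (1 : ℝ × ℝ → ENNReal) (w.1, z) := fun z =>
      (measurable_one.indicator hA).comp (measurable_fst.prodMk measurable_const)
    rw [← hE.setLIntegral_arm he he0 he1 true i (hg 1),
      ← hE.setLIntegral_arm he he0 he1 false i (hg (-1)),
      Measure.map_apply (hE.measurable_point i) hA,
      ← lintegral_indicator_one ((hE.measurable_point i) hA),
      ← lintegral_add_compl _ (hE.measurableSet_arm true i)]
    have hc : {ω | Z i ω = 1 ↔ (true = true)}ᶜ = {ω | Z i ω = 1 ↔ (false = true)} := by
      ext ω
      simp
    rw [hc]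
    congr 1
    · refine setLIntegral_congr_fun (hE.measurableSet_arm true i) fun ω hω => ?_
      have hω' : Z i ω = 1 := by simpa using hω
      refine indicator_eq_indicator_of_mem_iff ?_ rfl
      simp only [Set.mem_preimage, hω']
    · refine setLIntegral_congr_fun (hE.measurableSet_arm false i) fun ω hω => ?_
      have hω' : ¬ Z i ω = 1 := by simpa using hω
      refine indicator_eq_indicator_of_mem_iff ?_ rfl
      simp only [Set.mem_preimage, (hE.treatment i ω).resolve_left hω']
  ext A hA
  rw [hsplit i A hA, hsplit 0 A hA]

/-- Independence and identical distribution of the subjects turn the one-subject disintegration into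
a product, and regular conditional distributions are almost surely unique. The exceptional set
depends on `N` only, not on a bandwidth. -/
theorem IsExperiment.condDistrib_ae_eq (hE : IsExperiment P pop e X Yp Ym Z) (he : Measurable e)
    (he0 : ∀ x, 0 ≤ e x) (he1 : ∀ x, e x ≤ 1) (N : ℕ) :
    ∀ᵐ ω ∂P, condDistrib (observed Yp Ym Z N) (design X Z N) P (design X Z N ω) =
      Measure.pi fun i => outcomeKernel pop (design X Z N ω i) := by
  have hD : Measurable (design X Z N) := measurable_pi_iff.2 fun i => hE.measurable_point i
  have hY : Measurable (observed Yp Ym Z N) := measurable_pi_iff.2 fun i => hE.measurable_outcome i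
  set ν := P.map fun ω => (X 0 ω, Z 0 ω) with hν
  have : IsProbabilityMeasure ν :=
    Measure.isProbabilityMeasure_map (hE.measurable_point 0).aemeasurable
  have hobs : Measurable fun w : (ℝ × (ℝ × ℝ)) × ℝ =>
      ((w.1.1, w.2), if w.2 = 1 then w.1.2.1 else w.1.2.2) := by
    refine Measurable.prodMk (by fun_prop) (Measurable.ite ?_ (by fun_prop) (by fun_prop))
    exact measurable_snd (measurableSet_singleton 1)
  have hindY : iIndepFun (fun i ω => ((X i ω, Z i ω), outcome Yp Ym Z i ω)) P :=
    hE.indep.comp (fun _ w => ((w.1.1, w.2), if w.2 = 1 then w.1.2.1 else w.1.2.2))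
      fun _ => hobs
  have hindY' : iIndepFun (fun (i : Fin N) ω => ((X i ω, Z i ω), outcome Yp Ym Z i ω)) P :=
    hindY.precomp Fin.val_injective
  have hindD : iIndepFun (fun (i : Fin N) ω => (X i ω, Z i ω)) P :=
    hindY'.comp (fun _ => Prod.fst) fun _ => measurable_fst
  have mapD : P.map (design X Z N) = Measure.pi fun _ => ν := by
    have := (iIndepFun_iff_map_fun_eq_pi_map
      fun i : Fin N => (hE.measurable_point i).aemeasurable).1 hindD
    simp only [hE.map_point_eq he he0 he1] at this
    exact this
  have mapDY : P.map (fun ω => (design X Z N ω, observed Yp Ym Z N ω)) =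
      P.map (design X Z N) ⊗ₘ piKernel (outcomeKernel pop) := by
    have h1 := (iIndepFun_iff_map_fun_eq_pi_map fun i : Fin N =>
      ((hE.measurable_point i).prodMk (hE.measurable_outcome i)).aemeasurable).1 hindY'
    simp only [hE.map_point_outcome he he0 he1, hE.map_point_eq he he0 he1] at h1
    rw [← hν, ← map_pi_compProd_piKernel] at h1
    rw [mapD]
    refine (MeasurableEquiv.arrowProdEquivProdArrow (ℝ × ℝ) ℝ (Fin N)).symm.map_measurableEquiv_injective ?_
    rw [← h1, Measure.map_map (MeasurableEquiv.measurable _) (hD.prodMk hY)]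
    rfl
  have := condDistrib_ae_eq_of_measure_eq_compProd_of_measurable hD hY mapDY
  exact ae_of_ae_map hD.aemeasurable this

end Experiment

/-! ### The conditional mean squared error as bias and variance -/

/-- Bias-variance decomposition for independent coordinates. Second moments are asked only where the
weight is nonzero, since outcomes far from the threshold may lack them. -/
theorem integral_sq_sum_mul_sub_pi {ι : Type*} [Fintype ι] (μ : ι → Measure ℝ)
    [∀ i, IsProbabilityMeasure (μ i)] {w : ι → ℝ} (τ : ℝ)
    (hw : ∀ i, w i ≠ 0 → MemLp (fun y : ℝ => y) 2 (μ i)) :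
    ∫ y, (∑ i, w i * y i - τ) ^ 2 ∂(Measure.pi μ) =
      (∑ i, w i * ∫ y, y ∂(μ i) - τ) ^ 2 + ∑ i, w i ^ 2 * variance (fun y => y) (μ i) := by
  have hm : ∀ i, MemLp (fun y : ℝ => w i * y) 2 (μ i) := by
    intro i
    by_cases hi : w i = 0
    · simp [hi]
    · exact (hw i hi).const_mul (w i)
  have hm' : ∀ i, MemLp (fun y : ι → ℝ => w i * y i) 2 (Measure.pi μ) := fun i =>
    (hm i).comp_measurePreserving (measurePreserving_eval μ i)
  have hS : MemLp (∑ i, fun y : ι → ℝ => w i * y i) 2 (Measure.pi μ) :=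
    memLp_finsetSum' _ fun i _ => hm' i
  have hSf : (∑ i, fun y : ι → ℝ => w i * y i) = fun y => ∑ i, w i * y i := by
    ext y; simp
  have hvar := variance_sum_pi (X := fun i y => w i * y) hm
  rw [hSf] at hS hvar
  have hintg : ∫ y, ∑ i, w i * y i ∂(Measure.pi μ) = ∑ i, w i * ∫ y, y ∂(μ i) := by
    rw [integral_finsetSum _ fun i _ => (hm' i).integrable one_le_two]
    refine Finset.sum_congr rfl fun i _ => ?_
    have := (measurePreserving_eval μ i).map_eq
    rw [← integral_const_mul]
    conv_rhs => rw [← this]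
    rw [integral_map (measurable_pi_apply i).aemeasurable
      (by fun_prop)]
  have hτ : MemLp (fun y : ι → ℝ => ∑ i, w i * y i - τ) 2 (Measure.pi μ) :=
    hS.sub (memLp_const τ)
  have h1 := variance_eq_sub hτ
  rw [variance_sub_const hS.aestronglyMeasurable, hvar,
    integral_sub (hS.integrable one_le_two) (integrable_const _), hintg] at h1
  simp only [integral_const, probReal_univ, smul_eq_mul, one_mul, Pi.pow_apply] at h1
  have hv : ∀ i, variance (fun y => w i * y) (μ i) = w i ^ 2 * variance (fun y => y) (μ i) :=
    fun i => variance_const_mul (w i) (fun y => y) (μ i)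
  simp only [hv] at h1
  linarith

section Experiment

variable {Ω : Type*} [MeasurableSpace Ω] {P : Measure Ω} [IsProbabilityMeasure P]
  {pop : Superpopulation} {e : ℝ → ℝ} {X Yp Ym Z : ℕ → Ω → ℝ}

/-- An exact identity at a fixed `ω`, valid for every nonzero `h` with nondegenerate arms whose
weighted subjects have second moments. Since `hω` does not mention `h`, a bandwidth depending on `ω`
can be inserted. -/
theorem IsExperiment.condMSE_eq (hE : IsExperiment P pop e X Yp Ym Z) {K : ℝ → ℝ}
    (hK : ∀ u, 0 ≤ K u) {t : ℝ} {N : ℕ} {ω : Ω}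
    (hω : condDistrib (observed Yp Ym Z N) (design X Z N) P (design X Z N ω) =
      Measure.pi fun i => outcomeKernel pop (design X Z N ω i)) {h : ℝ} (hh : h ≠ 0)
    (hdet : ∀ b, 0 < wDet (armWeight K t h (design X Z N ω) b) (scaled t h (design X Z N ω)))
    (hmem : ∀ b i, armWeight K t h (design X Z N ω) b i ≠ 0 →
      MemLp (armOutcome b) 2 (pop.cond (X i ω))) :
      condMSE P pop K t X Yp Ym Z h N ω =
        ((∑ i : Fin N, interceptWeight (armWeight K t h (design X Z N ω) true)
            (scaled t h (design X Z N ω)) i * armMean pop true (X i ω) -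
          ∑ i : Fin N, interceptWeight (armWeight K t h (design X Z N ω) false)
            (scaled t h (design X Z N ω)) i * armMean pop false (X i ω)) - pop.tauThresh t) ^ 2 +
        (∑ i : Fin N, interceptWeight (armWeight K t h (design X Z N ω) true)
            (scaled t h (design X Z N ω)) i ^ 2 * armVar pop true (X i ω) +
          ∑ i : Fin N, interceptWeight (armWeight K t h (design X Z N ω) false)
            (scaled t h (design X Z N ω)) i ^ 2 * armVar pop false (X i ω)) := by
  set d := design X Z N ω with hd
  have htreat : ∀ i, (d i).2 = 1 ∨ (d i).2 = -1 := fun i => hE.treatment i ω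
  rw [condMSE, ← hd, hω]
  simp only [tauHat_eq_sum hK hh htreat (hdet true) (hdet false)]
  -- the weights of the two arms live on disjoint sets of subjects
  have harm : ∀ i : Fin N, ∃ b : Bool, ((d i).2 = 1 ↔ b = true) ∧
      armWeight K t h d (!b) i = 0 := by
    intro i
    by_cases hz : (d i).2 = 1
    · exact ⟨true, by simp [hz], by simp [armWeight, hz]⟩
    · exact ⟨false, by simp [hz], by simp [armWeight, hz]⟩
  have hzero : ∀ b i, armWeight K t h d b i = 0 →
      interceptWeight (armWeight K t h d b) (scaled t h d) i = 0 := by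
    intro b i hi
    rw [interceptWeight, hi]
    simp
  have hmeanvar : ∀ i (b : Bool), ((d i).2 = 1 ↔ b = true) →
      ∫ y, y ∂(outcomeKernel pop (d i)) = armMean pop b (X i ω) ∧
      variance (fun y => y) (outcomeKernel pop (d i)) = armVar pop b (X i ω) := by
    intro i b hb
    rw [outcomeKernel_apply pop hb, armMean_eq, armVar_eq]
    constructor
    · rw [integral_map (measurable_armOutcome b).aemeasurable (by fun_prop)]
      rfl
    · rw [variance_map (by fun_prop) (measurable_armOutcome b).aemeasurable]
      rfl
  rw [integral_sq_sum_mul_sub_pi]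
  · congr 1
    · congr 2
      rw [← Finset.sum_sub_distrib]
      refine Finset.sum_congr rfl fun i _ => ?_
      obtain ⟨b, hb, hb'⟩ := harm i
      rw [(hmeanvar i b hb).1, tauWeight]
      cases b
      · rw [hzero true i hb']; ring
      · rw [hzero false i hb']; ring
    · rw [← Finset.sum_add_distrib]
      refine Finset.sum_congr rfl fun i _ => ?_
      obtain ⟨b, hb, hb'⟩ := harm i
      rw [(hmeanvar i b hb).2, tauWeight]
      cases b
      · rw [hzero true i hb']; ring
      · rw [hzero false i hb']; ring
  · intro i hi
    obtain ⟨b, hb, hb'⟩ := harm i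
    have hne : armWeight K t h d b i ≠ 0 := by
      intro h0
      apply hi
      rw [tauWeight]
      cases b
      · rw [hzero true i hb', hzero false i h0, sub_zero]
      · rw [hzero true i h0, hzero false i hb', sub_zero]
    rw [outcomeKernel_apply pop hb]
    exact (memLp_map_measure_iff (by fun_prop) (measurable_armOutcome b).aemeasurable).2
      (hmem b i hne)

end Experiment

/-! ### A local law of large numbers -/

theorem armProb_nonneg {e : ℝ → ℝ} (he0 : ∀ x, 0 ≤ e x) (he1 : ∀ x, e x ≤ 1) (b : Bool) (x : ℝ) :
    0 ≤ armProb e b x := by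
  cases b
  · simpa [armProb] using he1 x
  · simpa [armProb] using he0 x

theorem armProb_le_one {e : ℝ → ℝ} (he0 : ∀ x, 0 ≤ e x) (he1 : ∀ x, e x ≤ 1) (b : Bool) (x : ℝ) :
    armProb e b x ≤ 1 := by
  cases b
  · simpa [armProb] using he0 x
  · simpa [armProb] using he1 x

theorem measurable_armProb {e : ℝ → ℝ} (he : Measurable e) (b : Bool) :
    Measurable (armProb e b) := by
  cases b
  · simpa [armProb] using! measurable_const.sub he
  · simpa [armProb] using! he

/-- Test functions: measurable, bounded and of bounded support. -/
structure IsTest (φ : ℝ → ℝ) : Prop where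
  measurable : Measurable φ
  bounded : ∃ B, ∀ u, |φ u| ≤ B
  support : ∃ M, ∀ u, M < |u| → φ u = 0

theorem IsTest.sq {φ : ℝ → ℝ} (h : IsTest φ) : IsTest fun u => φ u ^ 2 := by
  obtain ⟨B, hB⟩ := h.bounded
  obtain ⟨M, hM⟩ := h.support
  refine ⟨h.measurable.pow_const 2, ⟨B ^ 2, fun u => ?_⟩, ⟨M, fun u hu => by simp [hM u hu]⟩⟩
  rw [abs_pow]
  exact pow_le_pow_left₀ (abs_nonneg _) (hB u) 2

theorem IsTest.integrable_mul {φ w : ℝ → ℝ} (h : IsTest φ) (hw : Measurable w)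
    (hw1 : ∀ u, |w u| ≤ 1) : Integrable fun u => φ u * w u := by
  obtain ⟨B, hB⟩ := h.bounded
  obtain ⟨M, hM⟩ := h.support
  have hdom : Integrable (Set.indicator (Set.Icc (-M) M) fun _ : ℝ => B) :=
    (integrableOn_const (by simp)).integrable_indicator measurableSet_Icc
  refine hdom.mono' (h.measurable.mul hw).aestronglyMeasurable (ae_of_all _ fun u => ?_)
  by_cases hu : u ∈ Set.Icc (-M) M
  · rw [Set.indicator_of_mem hu, Real.norm_eq_abs, abs_mul]
    calc |φ u| * |w u| ≤ |φ u| * 1 := by gcongr; exact hw1 u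
      _ ≤ B := by rw [mul_one]; exact hB u
  · rw [Set.indicator_of_notMem hu, hM u (not_le.1 fun hc => hu (abs_le.1 hc))]
    simp

/-- Dominated convergence: the density is bounded near `t` by continuity, and the bounded support of
`φ` keeps `t + h * u` there once `h` is small. -/
theorem tendsto_integral_rescaled {pop : Superpopulation} {t : ℝ}
    (hf : ContinuousAt pop.density t) {w w0 : ℝ → ℝ} (hw : Measurable w) (hw0 : ∀ x, 0 ≤ w x)
    (hw1 : ∀ x, w x ≤ 1)
    (hlim : ∀ᵐ u, Tendsto (fun h => w (t + h * u)) (𝓝[>] 0) (𝓝 (w0 u)))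
    {φ : ℝ → ℝ} (hφ : IsTest φ) :
    Tendsto (fun h => ∫ u, pop.density (t + h * u) * w (t + h * u) * φ u) (𝓝[>] 0)
      (𝓝 (pop.density t * ∫ u, φ u * w0 u)) := by
  obtain ⟨B, hB⟩ := hφ.bounded
  obtain ⟨M, hM⟩ := hφ.support
  have hfb : ∀ᶠ x in 𝓝 t, pop.density x ≤ pop.density t + 1 :=
    (hf.eventually_lt_const (lt_add_one _)).mono fun x hx => hx.le
  obtain ⟨δ, hδ, hδf⟩ := Metric.eventually_nhds_iff.1 hfb
  rw [← integral_const_mul]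
  refine tendsto_integral_filter_of_dominated_convergence
    (Set.indicator (Set.Icc (-M) M) fun _ => (pop.density t + 1) * B) ?_ ?_ ?_ ?_
  · refine Eventually.of_forall fun h => Measurable.aestronglyMeasurable ?_
    have hm : Measurable fun u : ℝ => t + h * u := by fun_prop
    exact ((pop.measurable_density.comp hm).mul (hw.comp hm)).mul hφ.measurable
  · have hev : ∀ᶠ h : ℝ in 𝓝[>] 0, h * (|M| + 1) < δ := by
      have : Tendsto (fun h : ℝ => h * (|M| + 1)) (𝓝[>] 0) (𝓝 (0 * (|M| + 1))) :=
        (tendsto_id.mono_left nhdsWithin_le_nhds).mul_const _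
      rw [zero_mul] at this
      exact this.eventually_lt_const hδ
    filter_upwards [hev, self_mem_nhdsWithin] with h hh hpos
    refine ae_of_all _ fun u => ?_
    by_cases hu : u ∈ Set.Icc (-M) M
    · have hpos' : 0 < h := hpos
      have hu' : |u| ≤ M := abs_le.2 hu
      have hx : pop.density (t + h * u) ≤ pop.density t + 1 := by
        apply hδf
        rw [Real.dist_eq, add_sub_cancel_left, abs_mul, abs_of_pos hpos']
        refine lt_of_le_of_lt ?_ hh
        have : |u| ≤ |M| + 1 := by linarith [le_abs_self M]
        gcongr
      have h0 := pop.density_nonneg (t + h * u)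
      have hB0 : 0 ≤ B := (abs_nonneg _).trans (hB u)
      rw [Set.indicator_of_mem hu, Real.norm_eq_abs, abs_mul, abs_mul, abs_of_nonneg h0,
        abs_of_nonneg (hw0 _)]
      calc pop.density (t + h * u) * w (t + h * u) * |φ u|
          ≤ (pop.density t + 1) * 1 * B :=
            mul_le_mul (mul_le_mul hx (hw1 _) (hw0 _) (h0.trans hx)) (hB u) (abs_nonneg _)
              (mul_nonneg (h0.trans hx) zero_le_one)
        _ = (pop.density t + 1) * B := by ring
    · rw [Set.indicator_of_notMem hu, hM u (not_le.1 fun hc => hu (abs_le.1 hc))]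
      simp
  · exact (integrableOn_const (by simp)).integrable_indicator measurableSet_Icc
  · filter_upwards [hlim] with u hu
    have h1 : Tendsto (fun h : ℝ => t + h * u) (𝓝[>] 0) (𝓝 t) := by
      have : Tendsto (fun h : ℝ => t + h * u) (𝓝 0) (𝓝 (t + 0 * u)) :=
        (Continuous.tendsto (by fun_prop) 0)
      rw [zero_mul, add_zero] at this
      exact this.mono_left nhdsWithin_le_nhds
    have := ((hf.tendsto.comp h1).mul hu).mul_const (φ u)
    rw [show pop.density t * (φ u * w0 u) = pop.density t * w0 u * φ u by ring]
    exact this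

section Experiment

variable {Ω : Type*} [MeasurableSpace Ω] {P : Measure Ω} [IsProbabilityMeasure P]
  {pop : Superpopulation} {e : ℝ → ℝ} {X Yp Ym Z : ℕ → Ω → ℝ}

theorem IsExperiment.setIntegral_arm (hE : IsExperiment P pop e X Yp Ym Z) (he : Measurable e)
    (he0 : ∀ x, 0 ≤ e x) (he1 : ∀ x, e x ≤ 1) (b : Bool) (i : ℕ) {g : ℝ → ℝ} (hg : Measurable g) :
    ∫ ω in {ω | Z i ω = 1 ↔ b}, g (X i ω) ∂P = ∫ x, pop.density x * armProb e b x * g x := by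
  have hm : Measurable fun x => ENNReal.ofReal (pop.density x * armProb e b x) :=
    (pop.measurable_density.mul (measurable_armProb he b)).ennreal_ofReal
  have hmap : (P.restrict {ω | Z i ω = 1 ↔ b}).map (X i) =
      volume.withDensity fun x => ENNReal.ofReal (pop.density x * armProb e b x) := by
    ext A hA
    rw [Measure.map_apply (hE.measurable_X i) hA, withDensity_apply _ hA,
      ← lintegral_indicator_one ((hE.measurable_X i) hA), ← lintegral_indicator hA]
    have h := hE.setLIntegral_arm he he0 he1 b i (g := fun w => A.indicator 1 w.1)
      ((measurable_one.indicator hA).comp measurable_fst)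
    refine Eq.trans ?_ (h.trans ?_)
    · rfl
    · refine lintegral_congr fun x => ?_
      rw [show (fun y : ℝ × ℝ => A.indicator (1 : ℝ → ENNReal) (x, y).1) =
        fun _ => A.indicator 1 x from rfl, MeasureTheory.lintegral_const, measure_univ, mul_one,
        ← mul_assoc, ← ENNReal.ofReal_mul (pop.density_nonneg x)]
      by_cases hx : x ∈ A <;> simp [hx]
  rw [← integral_map (hE.measurable_X i).aemeasurable hg.aestronglyMeasurable, hmap,
    integral_withDensity_eq_integral_toReal_smul hm (ae_of_all _ fun _ => ENNReal.ofReal_lt_top)]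
  refine integral_congr_ae (ae_of_all _ fun x => ?_)
  simp only [smul_eq_mul]
  rw [ENNReal.toReal_ofReal (mul_nonneg (pop.density_nonneg x) (armProb_nonneg he0 he1 b x))]

/-- The kernel-type average of a test function over an arm of the experiment. -/
def localAverage (t : ℝ) (X Z : ℕ → Ω → ℝ) (b : Bool) (φ : ℝ → ℝ) (h : ℝ) (N : ℕ) (ω : Ω) : ℝ :=
  (∑ i : Fin N, if Z i ω = 1 ↔ b then φ ((X i ω - t) / h) else 0) / (N * h)

/-- The mean converges by rescaling. The variance is at most that of `N` independent terms of second
moment O(h), divided by (N h)², hence O(1/(N h)), and Chebyshev's inequality concludes. -/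
theorem IsExperiment.tendsto_localAverage (hE : IsExperiment P pop e X Yp Ym Z)
    (he : Measurable e) (he0 : ∀ x, 0 ≤ e x) (he1 : ∀ x, e x ≤ 1) {t : ℝ}
    (hf : ContinuousAt pop.density t) {b : Bool} {w0 : ℝ → ℝ}
    (hlim : ∀ᵐ u, Tendsto (fun h => armProb e b (t + h * u)) (𝓝[>] 0) (𝓝 (w0 u)))
    {φ : ℝ → ℝ} (hφ : IsTest φ) {h : ℕ → ℝ} (hpos : ∀ᶠ N in atTop, 0 < h N)
    (h0 : Tendsto h atTop (𝓝 0)) (hN : Tendsto (fun N => N * h N) atTop atTop) :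
    Tendsto (fun q : ℕ × Ω => localAverage t X Z b φ (h q.1) q.1 q.2) (probFilter P)
      (𝓝 (pop.density t * ∫ u, φ u * w0 u)) := by
  have h0' : Tendsto h atTop (𝓝[>] 0) := tendsto_nhdsWithin_iff.2 ⟨h0, hpos⟩
  set V : ℕ → ℕ → Ω → ℝ := fun N i ω => if Z i ω = 1 ↔ b then φ ((X i ω - t) / h N) else 0 with hV
  have hVind : ∀ N i, V N i = Set.indicator {ω | Z i ω = 1 ↔ b}
      (fun ω => φ ((X i ω - t) / h N)) := by
    intro N i
    ext ω
    by_cases hω : (Z i ω = 1 ↔ b = true)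
    · rw [Set.indicator_of_mem (by exact hω)]
      simp only [hV, hω, if_true]
    · rw [Set.indicator_of_notMem (by exact hω)]
      simp only [hV, hω, if_false]
  obtain ⟨B, hB⟩ := hφ.bounded
  have hmV : ∀ N i, Measurable (V N i) := by
    intro N i
    rw [hVind]
    refine Measurable.indicator ?_ (hE.measurableSet_arm b i)
    exact hφ.measurable.comp (((hE.measurable_X i).sub_const t).div_const (h N))
  have hLp : ∀ N i, MemLp (V N i) 2 P := by
    intro N i
    refine MemLp.of_bound (hmV N i).aestronglyMeasurable |B| (ae_of_all _ fun ω => ?_)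
    simp only [hV]
    split_ifs
    · exact (hB _).trans (le_abs_self B)
    · simp
  have hInt : ∀ {g : ℝ → ℝ}, Measurable g → ∀ N i, 0 < h N →
      ∫ ω in {ω | Z i ω = 1 ↔ b}, g ((X i ω - t) / h N) ∂P =
        h N * ∫ u, pop.density (t + h N * u) * armProb e b (t + h N * u) * g u := by
    intro g hg N i hNpos
    rw [hE.setIntegral_arm he he0 he1 b i (g := fun x => g ((x - t) / h N))
      (hg.comp ((measurable_id.sub_const t).div_const (h N)))]
    -- The substitution x = t + h u, done as a dilation followed by a translation.
    have e1 := Measure.integral_comp_mul_left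
      (fun x => pop.density (t + x) * armProb e b (t + x) * g (x / h N)) (h N)
    have e2 := integral_add_left_eq_self (μ := (volume : Measure ℝ))
      (fun x => pop.density x * armProb e b x * g ((x - t) / h N)) t
    simp only [add_sub_cancel_left] at e2
    rw [e2] at e1
    have e3 : ∀ u : ℝ, h N * u / h N = u := fun u => by field_simp
    simp only [e3] at e1
    rw [e1, smul_eq_mul, abs_of_pos (inv_pos.2 hNpos), ← mul_assoc, mul_inv_cancel₀ hNpos.ne',
      one_mul]
  set m : ℕ → ℝ := fun N =>
    ∫ u, pop.density (t + h N * u) * armProb e b (t + h N * u) * φ u with hm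
  set s : ℕ → ℝ := fun N =>
    ∫ u, pop.density (t + h N * u) * armProb e b (t + h N * u) * φ u ^ 2 with hs
  have hmlim : Tendsto m atTop (𝓝 (pop.density t * ∫ u, φ u * w0 u)) :=
    (tendsto_integral_rescaled hf (measurable_armProb he b) (armProb_nonneg he0 he1 b)
      (armProb_le_one he0 he1 b) hlim hφ).comp h0'
  have hslim : Tendsto s atTop (𝓝 (pop.density t * ∫ u, φ u ^ 2 * w0 u)) :=
    (tendsto_integral_rescaled hf (measurable_armProb he b) (armProb_nonneg he0 he1 b)
      (armProb_le_one he0 he1 b) hlim hφ.sq).comp h0'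
  have hEV : ∀ N i, 0 < h N → ∫ ω, V N i ω ∂P = h N * m N := by
    intro N i hNpos
    rw [hVind, integral_indicator (hE.measurableSet_arm b i), hInt hφ.measurable N i hNpos]
  have hVarV : ∀ N i, 0 < h N → variance (V N i) P ≤ h N * s N := by
    intro N i hNpos
    refine (variance_le_expectation_sq (hmV N i).aestronglyMeasurable).trans (le_of_eq ?_)
    rw [← hInt (hφ.measurable.pow_const 2) N i hNpos, ← integral_indicator (hE.measurableSet_arm b i)]
    congr 1
    ext ω
    simp only [hVind, Pi.pow_apply]
    by_cases hω : ω ∈ {ω | Z i ω = 1 ↔ b = true}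
    · rw [Set.indicator_of_mem hω, Set.indicator_of_mem hω]
    · rw [Set.indicator_of_notMem hω, Set.indicator_of_notMem hω]; norm_num
  have hind : ∀ N, Set.Pairwise (Finset.range N : Set ℕ) fun i j => V N i ⟂ᵢ[P] V N j := by
    intro N i _ j _ hij
    have hg : Measurable fun w : (ℝ × (ℝ × ℝ)) × ℝ =>
        if w.2 = 1 ↔ b then φ ((w.1.1 - t) / h N) else 0 := by
      refine Measurable.ite ?_ (hφ.measurable.comp (by fun_prop)) measurable_const
      have h1 : MeasurableSet {w : (ℝ × (ℝ × ℝ)) × ℝ | w.2 = 1} :=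
        measurable_snd (measurableSet_singleton 1)
      cases b
      · have e : {w : (ℝ × (ℝ × ℝ)) × ℝ | w.2 = 1 ↔ (false = true)} =
            {w : (ℝ × (ℝ × ℝ)) × ℝ | w.2 = 1}ᶜ := by ext w; simp
        rw [e]; exact h1.compl
      · simpa using! h1
    exact (hE.indep.comp (fun _ w => if w.2 = 1 ↔ b then φ ((w.1.1 - t) / h N) else 0)
      fun _ => hg).indepFun hij
  set A : ℕ → Ω → ℝ := fun N ω => localAverage t X Z b φ (h N) N ω with hA
  have hAeq : ∀ N, A N = fun ω => (N * h N)⁻¹ * (∑ i ∈ Finset.range N, V N i) ω := by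
    intro N
    ext ω
    rw [hA, Finset.sum_apply, Finset.sum_range, inv_mul_eq_div]
    rfl
  have hALp : ∀ N, MemLp (A N) 2 P := by
    intro N
    rw [hAeq]
    exact (memLp_finsetSum' _ fun i _ => hLp N i).const_mul _
  have hEA : ∀ᶠ N in atTop, ∫ ω, A N ω ∂P = m N := by
    filter_upwards [hpos, eventually_gt_atTop 0] with N hNpos hN0
    rw [hAeq, integral_const_mul]
    simp only [Finset.sum_apply]
    rw [integral_finsetSum _ fun i _ => (hLp N i).integrable one_le_two]
    simp only [hEV N _ hNpos, Finset.sum_const, Finset.card_range, nsmul_eq_mul]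
    have : (N : ℝ) ≠ 0 := by positivity
    field_simp
  have hVarA : ∀ᶠ N in atTop, variance (A N) P ≤ s N / (N * h N) := by
    filter_upwards [hpos, eventually_gt_atTop 0] with N hNpos hN0
    have hN' : (0 : ℝ) < N := by positivity
    rw [hAeq, variance_const_mul, IndepFun.variance_sum (fun i _ => hLp N i) (hind N)]
    calc ((N * h N)⁻¹) ^ 2 * ∑ i ∈ Finset.range N, variance (V N i) P
        ≤ ((N * h N)⁻¹) ^ 2 * ∑ i ∈ Finset.range N, h N * s N := by
          gcongr with i _
          exact hVarV N i hNpos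
      _ = s N / (N * h N) := by
          simp only [Finset.sum_const, Finset.card_range, nsmul_eq_mul]
          field_simp
  have hdev : Tendsto (fun q : ℕ × Ω => A q.1 q.2 - ∫ ω, A q.1 ω ∂P) (probFilter P) (𝓝 0) := by
    rw [Metric.tendsto_nhds]
    intro ε hε
    rw [eventually_probFilter_iff]
    have hlim0 : Tendsto (fun N => ENNReal.ofReal (s N / (N * h N) / ε ^ 2)) atTop (𝓝 0) := by
      have := ((hslim.div_atTop hN).div_const (ε ^ 2))
      rw [zero_div] at this
      simpa using ENNReal.tendsto_ofReal this
    refine tendsto_of_tendsto_of_tendsto_of_le_of_le' tendsto_const_nhds hlim0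
      (Eventually.of_forall fun _ => zero_le) ?_
    filter_upwards [hVarA] with N hN
    simp only [Real.dist_eq, sub_zero, not_lt]
    refine (meas_ge_le_variance_div_sq (hALp N) hε).trans (ENNReal.ofReal_le_ofReal ?_)
    gcongr
  have hmean : Tendsto (fun q : ℕ × Ω => ∫ ω, A q.1 ω ∂P) (probFilter P)
      (𝓝 (pop.density t * ∫ u, φ u * w0 u)) :=
    (hmlim.congr' (hEA.mono fun N hN => hN.symm)).comp tendsto_fst_probFilter
  simpa using hdev.add hmean

end Experiment

/-! ### The local law of large numbers at a random bandwidth -/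

/-- Profiles of local averages: supported in `[-1, 1]` and continuous there. -/
structure IsProfile (ψ : ℝ → ℝ) : Prop where
  measurable : Measurable ψ
  bounded : ∃ B, ∀ u, |ψ u| ≤ B
  support : ∀ u, 1 < |u| → ψ u = 0
  continuousOn : ContinuousOn ψ (Set.Icc (-1) 1)

theorem IsProfile.isTest {ψ : ℝ → ℝ} (h : IsProfile ψ) : IsTest ψ :=
  ⟨h.measurable, h.bounded, ⟨1, h.support⟩⟩

/-- The effect of a small change of scale on a profile is dominated by a test function of small
integral. -/
theorem IsProfile.exists_modulus {ψ : ℝ → ℝ} (hψ : IsProfile ψ) {ε : ℝ} (hε : 0 < ε) :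
    ∃ δ > 0, ∃ D : ℝ → ℝ, IsTest D ∧ (∀ u, 0 ≤ D u) ∧ ∫ u, D u < ε ∧
      ∀ r, |r - 1| ≤ δ → ∀ u, |ψ (r * u) - ψ u| ≤ D u := by
  obtain ⟨B, hB⟩ := hψ.bounded
  have hB0 : 0 ≤ B := (abs_nonneg _).trans (hB 0)
  have huc := isCompact_Icc.uniformContinuousOn_of_continuous hψ.continuousOn
  obtain ⟨δ', hδ', hδ'u⟩ := Metric.uniformContinuousOn_iff.1 huc (ε / 16) (by positivity)
  -- The budget: the interior part contributes 4 · ε/16 = ε/4, and the two boundary strips 2 · 4δ ·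
  -- 2B = 16 B δ ≤ ε/2. The bound 1/4 gives (1 - δ)(1 + 2δ) > 1, used outside the support.
  set δ := min (1 / 4) (min (δ' / 2) (ε / (32 * (B + 1)))) with hδdef
  have hδ : 0 < δ := by
    refine lt_min (by norm_num) (lt_min (by positivity) (by positivity))
  have hδ1 : δ ≤ 1 / 4 := min_le_left _ _
  have hδ2 : δ < δ' := by
    have : δ ≤ δ' / 2 := (min_le_right _ _).trans (min_le_left _ _)
    linarith
  have hδ3 : B * δ ≤ ε / 32 := by
    have h1 : δ ≤ ε / (32 * (B + 1)) := (min_le_right _ _).trans (min_le_right _ _)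
    calc B * δ ≤ (B + 1) * (ε / (32 * (B + 1))) := by gcongr; linarith
      _ = ε / 32 := by field_simp
  -- `D1` absorbs the modulus of continuity inside `[-1, 1]`; `D2` and `D3` cover the strips around
  -- 1 and -1, where the profile may jump and only its supremum is available.
  set D1 : ℝ → ℝ := Set.indicator (Set.Icc (-2) 2) fun _ => ε / 16 with hD1
  set D2 : ℝ → ℝ := Set.indicator (Set.Icc (1 - 2 * δ) (1 + 2 * δ)) fun _ => 2 * B with hD2
  set D3 : ℝ → ℝ := Set.indicator (Set.Icc (-1 - 2 * δ) (-1 + 2 * δ)) fun _ => 2 * B with hD3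
  have n1 : ∀ u, 0 ≤ D1 u := fun u => Set.indicator_nonneg (fun _ _ => by positivity) u
  have n2 : ∀ u, 0 ≤ D2 u := fun u => Set.indicator_nonneg (fun _ _ => by positivity) u
  have n3 : ∀ u, 0 ≤ D3 u := fun u => Set.indicator_nonneg (fun _ _ => by positivity) u
  have l1 : ∀ u, D1 u ≤ ε / 16 := fun u => Set.indicator_le_self' (fun _ _ => by positivity) u
  have l2 : ∀ u, D2 u ≤ 2 * B := fun u => Set.indicator_le_self' (fun _ _ => by positivity) u
  have l3 : ∀ u, D3 u ≤ 2 * B := fun u => Set.indicator_le_self' (fun _ _ => by positivity) u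
  have i1 : Integrable D1 := (integrableOn_const (by simp)).integrable_indicator measurableSet_Icc
  have i2 : Integrable D2 := (integrableOn_const (by simp)).integrable_indicator measurableSet_Icc
  have i3 : Integrable D3 := (integrableOn_const (by simp)).integrable_indicator measurableSet_Icc
  refine ⟨δ, hδ, fun u => D1 u + D2 u + D3 u, ⟨?_, ⟨ε / 16 + 2 * B + 2 * B, fun u => ?_⟩,
    ⟨2, fun u hu => ?_⟩⟩, fun u => add_nonneg (add_nonneg (n1 u) (n2 u)) (n3 u), ?_, ?_⟩
  · exact ((measurable_const.indicator measurableSet_Icc).add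
      (measurable_const.indicator measurableSet_Icc)).add
      (measurable_const.indicator measurableSet_Icc)
  · rw [abs_of_nonneg (add_nonneg (add_nonneg (n1 u) (n2 u)) (n3 u))]
    exact add_le_add (add_le_add (l1 u) (l2 u)) (l3 u)
  · rw [hD1, hD2, hD3, Set.indicator_of_notMem, Set.indicator_of_notMem, Set.indicator_of_notMem]
    · ring
    · intro h
      have : |u| ≤ 2 := abs_le.2 ⟨by linarith [h.1], by linarith [h.2]⟩
      linarith
    · intro h
      have : |u| ≤ 2 := abs_le.2 ⟨by linarith [h.1], by linarith [h.2]⟩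
      linarith
    · intro h
      have : |u| ≤ 2 := abs_le.2 h
      linarith
  · change ∫ u, (D1 u + D2 u) + D3 u < ε
    have e1 : ∫ u, (D1 u + D2 u) + D3 u = (∫ u, D1 u + D2 u) + ∫ u, D3 u :=
      integral_add (i1.add i2) i3
    rw [e1, integral_add i1 i2, hD1, hD2, hD3,
      integral_indicator measurableSet_Icc, integral_indicator measurableSet_Icc,
      integral_indicator measurableSet_Icc]
    simp only [setIntegral_const, Measure.real, Real.volume_Icc, smul_eq_mul]
    rw [ENNReal.toReal_ofReal (by norm_num), ENNReal.toReal_ofReal (by linarith),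
      ENNReal.toReal_ofReal (by linarith)]
    nlinarith
  · intro r hr u
    have hr' := abs_le.1 hr
    have hru : |r * u - u| ≤ δ * |u| := by
      rw [show r * u - u = (r - 1) * u by ring, abs_mul]
      gcongr
    by_cases hin : |u| < 1 - 2 * δ
    · have h1 : |r * u - u| ≤ δ := hru.trans (by nlinarith [abs_nonneg u])
      have hu1 : |u| ≤ 1 := by linarith
      have hu2 : |r * u| ≤ 1 := by
        have := abs_sub_abs_le_abs_sub (r * u) u
        linarith
      have hd := hδ'u (r * u) (abs_le.1 hu2) u (abs_le.1 hu1)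
        (by rw [Real.dist_eq]; linarith)
      rw [Real.dist_eq] at hd
      have hD : D1 u = ε / 16 := Set.indicator_of_mem
        (show u ∈ Set.Icc (-2 : ℝ) 2 from abs_le.1 (by linarith)) _
      linarith [n2 u, n3 u]
    by_cases hout : 1 + 2 * δ < |u|
    · have h2 : 1 < |r * u| := by
        rw [abs_mul, abs_of_nonneg (by linarith : (0 : ℝ) ≤ r)]
        nlinarith
      rw [hψ.support _ h2, hψ.support u (by linarith), sub_zero, abs_zero]
      exact add_nonneg (add_nonneg (n1 u) (n2 u)) (n3 u)
    · push Not at hin hout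
      have h1 : |ψ (r * u) - ψ u| ≤ 2 * B := by
        refine (abs_sub _ _).trans ?_
        linarith [hB (r * u), hB u]
      rcases le_total 0 u with hu | hu
      · rw [abs_of_nonneg hu] at hin hout
        have hD : D2 u = 2 * B := Set.indicator_of_mem
          (show u ∈ Set.Icc (1 - 2 * δ) (1 + 2 * δ) from ⟨hin, hout⟩) _
        linarith [n1 u, n3 u]
      · rw [abs_of_nonpos hu] at hin hout
        have hD : D3 u = 2 * B := Set.indicator_of_mem
          (show u ∈ Set.Icc (-1 - 2 * δ) (-1 + 2 * δ) from ⟨by linarith, by linarith⟩) _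
        linarith [n1 u, n2 u]

section Experiment

variable {Ω : Type*} [MeasurableSpace Ω] {P : Measure Ω} [IsProbabilityMeasure P]
  {pop : Superpopulation} {e : ℝ → ℝ} {X Yp Ym Z : ℕ → Ω → ℝ}

/-- Replacing h by H rescales the argument of `ψ` by r = h/H → 1. The change is at most the local
average, at the deterministic bandwidth, of the dominating function of `exists_modulus`, which does
not depend on r and has a small limit. This is uniform in r, so any dependence of H on the data is
allowed. -/
theorem IsExperiment.tendsto_localAverage_random (hE : IsExperiment P pop e X Yp Ym Z)
    (he : Measurable e) (he0 : ∀ x, 0 ≤ e x) (he1 : ∀ x, e x ≤ 1) {t : ℝ}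
    (hf : ContinuousAt pop.density t) {b : Bool} {w0 : ℝ → ℝ} (hw : Measurable w0)
    (hw0 : ∀ u, 0 ≤ w0 u) (hw1 : ∀ u, w0 u ≤ 1)
    (hlim : ∀ᵐ u, Tendsto (fun h => armProb e b (t + h * u)) (𝓝[>] 0) (𝓝 (w0 u)))
    {ψ : ℝ → ℝ} (hψ : IsProfile ψ) {h : ℕ → ℝ} (hpos : ∀ᶠ N in atTop, 0 < h N)
    (h0 : Tendsto h atTop (𝓝 0)) (hN : Tendsto (fun N => N * h N) atTop atTop)
    {H : ℕ → Ω → ℝ}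
    (hH : Tendsto (fun q : ℕ × Ω => H q.1 q.2 / h q.1) (probFilter P) (𝓝 1)) :
    Tendsto (fun q : ℕ × Ω => localAverage t X Z b ψ (H q.1 q.2) q.1 q.2) (probFilter P)
      (𝓝 (pop.density t * ∫ u, ψ u * w0 u)) := by
  have hfix := hE.tendsto_localAverage he he0 he1 hf hlim hψ.isTest hpos h0 hN
  have hr : Tendsto (fun q : ℕ × Ω => h q.1 / H q.1 q.2) (probFilter P) (𝓝 1) := by
    have := hH.inv₀ one_ne_zero
    rw [inv_one] at this
    exact this.congr fun q => inv_div _ _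
  have hposL : ∀ᶠ q : ℕ × Ω in probFilter P, 0 < h q.1 := tendsto_fst_probFilter.eventually hpos
  set A : ℕ × Ω → ℝ := fun q =>
    (∑ i : Fin q.1, if Z i q.2 = 1 ↔ b then
      ψ (h q.1 / H q.1 q.2 * ((X i q.2 - t) / h q.1)) else 0) / (q.1 * h q.1) with hA
  have hAlim : Tendsto A (probFilter P) (𝓝 (pop.density t * ∫ u, ψ u * w0 u)) := by
    suffices hdiff : Tendsto (fun q => A q - localAverage t X Z b ψ (h q.1) q.1 q.2)
        (probFilter P) (𝓝 0) by simpa using hdiff.add hfix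
    rw [Metric.tendsto_nhds]
    intro ε hε
    have hft : 0 ≤ pop.density t := pop.density_nonneg t
    obtain ⟨δ, hδ, D, hD, hD0, hDi, hDb⟩ :=
      hψ.exists_modulus (ε := ε / (pop.density t + 1)) (by positivity)
    have hlimD := hE.tendsto_localAverage he he0 he1 hf hlim hD hpos h0 hN
    have hDint : Integrable D := by
      simpa using hD.integrable_mul (w := fun _ => 1) measurable_const (by simp)
    have hw0D : (∫ u, D u * w0 u) ≤ (∫ u, D u) := by
      refine integral_mono (hD.integrable_mul hw fun u => ?_) hDint fun u => ?_
      · rw [abs_of_nonneg (hw0 u)]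
        exact hw1 u
      · exact mul_le_of_le_one_right (hD0 u) (hw1 u)
    have hlt : pop.density t * ∫ u, D u * w0 u < ε := by
      calc pop.density t * ∫ u, D u * w0 u
          ≤ pop.density t * (ε / (pop.density t + 1)) := by
            gcongr
            exact hw0D.trans hDi.le
        _ < (pop.density t + 1) * (ε / (pop.density t + 1)) := by
            gcongr
            linarith
        _ = ε := by field_simp
    have hrδ : ∀ᶠ q : ℕ × Ω in probFilter P, |h q.1 / H q.1 q.2 - 1| ≤ δ := by
      filter_upwards [(Metric.tendsto_nhds.1 hr) δ hδ] with q hq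
      exact (Real.dist_eq _ _ ▸ hq).le
    filter_upwards [hlimD.eventually_lt_const hlt, hrδ, hposL] with q hq1 hq2 hq3
    rw [Real.dist_eq, sub_zero]
    refine lt_of_le_of_lt ?_ hq1
    simp only [hA, localAverage]
    rw [← sub_div, abs_div, ← Finset.sum_sub_distrib,
      abs_of_nonneg (mul_nonneg (Nat.cast_nonneg q.1) hq3.le)]
    refine div_le_div_of_nonneg_right ?_ (mul_nonneg (Nat.cast_nonneg q.1) hq3.le)
    refine (Finset.abs_sum_le_sum_abs _ _).trans (Finset.sum_le_sum fun i _ => ?_)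
    split_ifs
    · exact hDb _ hq2 _
    · simp
  -- `A` already evaluates the profile at scale H but is normalized by N h; the factor h/H corrects
  -- this.
  have hprod := hr.mul hAlim
  rw [one_mul] at hprod
  refine hprod.congr' ?_
  filter_upwards [hposL] with q hq
  have hq' := hq.ne'
  simp only [hA, localAverage]
  rw [div_mul_div_comm, mul_comm (h q.1), mul_comm (H q.1 q.2), mul_right_comm,
    mul_div_mul_right _ _ hq']
  congr 1
  refine Finset.sum_congr rfl fun i _ => ?_
  congr 2
  rw [div_mul_div_comm, mul_comm (h q.1), mul_div_mul_right _ _ hq']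

end Experiment

/-! ### Bias and variance of a local linear intercept -/

section LeastSquares

variable {ι : Type*} [Fintype ι]

theorem abs_interceptWeight_le {k u : ι → ℝ} (hk : ∀ i, 0 ≤ k i) (hd : 0 < wDet k u)
    (hu : ∀ i, k i ≠ 0 → |u i| ≤ 1) (i : ι) :
    |interceptWeight k u i| ≤ k i * (wMoment k u 2 + |wMoment k u 1|) / wDet k u := by
  have hs2 : 0 ≤ wMoment k u 2 := Finset.sum_nonneg fun i _ => mul_nonneg (hk i) (sq_nonneg _)
  rw [interceptWeight, abs_div, abs_mul, abs_of_nonneg (hk i), abs_of_pos hd]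
  by_cases hi : k i = 0
  · simp [hi]
  · refine div_le_div_of_nonneg_right (mul_le_mul_of_nonneg_left ?_ (hk i)) hd.le
    refine (abs_sub _ _).trans ?_
    rw [abs_of_nonneg hs2, abs_mul]
    have := mul_le_mul_of_nonneg_left (hu i hi) (abs_nonneg (wMoment k u 1))
    linarith

/-- The constant part of the Taylor expansion is reproduced and the linear part annihilated, so the
quadratic term and the remainder are all that is left. On the support of the weights the remainder
is bounded through `abs_interceptWeight_le`. -/
theorem abs_sum_interceptWeight_mul_sub_le {k u g : ι → ℝ} {a₀ a₁ c η h : ℝ}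
    (hk : ∀ i, 0 ≤ k i) (hd : 0 < wDet k u) (hu : ∀ i, k i ≠ 0 → |u i| ≤ 1)
    (hg : ∀ i, k i ≠ 0 → |g i - a₀ - a₁ * (h * u i) - c * (h * u i) ^ 2| ≤ η * (h * u i) ^ 2) :
    |(∑ i, interceptWeight k u i * g i - a₀) -
        h ^ 2 * (c * ∑ i, interceptWeight k u i * u i ^ 2)| ≤
      h ^ 2 * (η * ((wMoment k u 2 + |wMoment k u 1|) * wMoment k u 2 / wDet k u)) := by
  have e0 := sum_interceptWeight hd.ne'
  have e1 : ∑ i, interceptWeight k u i * u i = 0 := sum_interceptWeight_mul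
  have hrem : (∑ i, interceptWeight k u i * g i - a₀) -
        h ^ 2 * (c * ∑ i, interceptWeight k u i * u i ^ 2) =
      ∑ i, interceptWeight k u i * (g i - a₀ - a₁ * (h * u i) - c * (h * u i) ^ 2) := by
    have : ∑ i, interceptWeight k u i * (g i - a₀ - a₁ * (h * u i) - c * (h * u i) ^ 2) =
        ∑ i, interceptWeight k u i * g i - a₀ * ∑ i, interceptWeight k u i -
          a₁ * h * ∑ i, interceptWeight k u i * u i -
          h ^ 2 * c * ∑ i, interceptWeight k u i * u i ^ 2 := by
      simp only [Finset.mul_sum, ← Finset.sum_sub_distrib]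
      exact Finset.sum_congr rfl fun i _ => by ring
    rw [this, e0, e1]
    ring
  rw [hrem]
  refine (Finset.abs_sum_le_sum_abs _ _).trans ?_
  have hterm : ∀ i, |interceptWeight k u i * (g i - a₀ - a₁ * (h * u i) - c * (h * u i) ^ 2)| ≤
      (k i * (wMoment k u 2 + |wMoment k u 1|) / wDet k u) * (η * (h * u i) ^ 2) := by
    intro i
    rw [abs_mul]
    by_cases hi : k i = 0
    · simp [interceptWeight, hi]
    · exact mul_le_mul (abs_interceptWeight_le hk hd hu i) (hg i hi) (abs_nonneg _)
        ((abs_nonneg _).trans (abs_interceptWeight_le hk hd hu i))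
  refine (Finset.sum_le_sum fun i _ => hterm i).trans (le_of_eq ?_)
  have hs : wMoment k u 2 = ∑ i, k i * u i ^ 2 := rfl
  have : ∀ i, (k i * (wMoment k u 2 + |wMoment k u 1|) / wDet k u) * (η * (h * u i) ^ 2) =
      h ^ 2 * (η * ((wMoment k u 2 + |wMoment k u 1|) / wDet k u)) * (k i * u i ^ 2) := by
    intro i
    ring
  simp only [this]
  rw [← Finset.mul_sum, ← hs]
  ring

theorem sum_interceptWeight_sq (k u : ι → ℝ) :
    ∑ i, interceptWeight k u i ^ 2 =
      (wMoment k u 2 ^ 2 * wMoment (fun i => k i ^ 2) u 0 -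
        2 * wMoment k u 1 * wMoment k u 2 * wMoment (fun i => k i ^ 2) u 1 +
        wMoment k u 1 ^ 2 * wMoment (fun i => k i ^ 2) u 2) / wDet k u ^ 2 := by
  simp only [interceptWeight, div_pow]
  rw [← Finset.sum_div, wMoment.eq_1 _ u 0, wMoment.eq_1 (fun i => k i ^ 2) u 1,
    wMoment.eq_1 (fun i => k i ^ 2) u 2, Finset.mul_sum, Finset.mul_sum, Finset.mul_sum,
    ← Finset.sum_sub_distrib, ← Finset.sum_add_distrib]
  congr 1
  exact Finset.sum_congr rfl fun i _ => by ring

theorem abs_sum_interceptWeight_sq_mul_sub_le {k u v : ι → ℝ} {v₀ η : ℝ}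
    (hv : ∀ i, k i ≠ 0 → |v i - v₀| ≤ η) :
    |∑ i, interceptWeight k u i ^ 2 * v i - v₀ * ∑ i, interceptWeight k u i ^ 2| ≤
      η * ∑ i, interceptWeight k u i ^ 2 := by
  rw [Finset.mul_sum, Finset.mul_sum, ← Finset.sum_sub_distrib]
  refine (Finset.abs_sum_le_sum_abs _ _).trans (Finset.sum_le_sum fun i _ => ?_)
  rw [show interceptWeight k u i ^ 2 * v i - v₀ * interceptWeight k u i ^ 2 =
    (v i - v₀) * interceptWeight k u i ^ 2 by ring, abs_mul,
    abs_of_nonneg (sq_nonneg (interceptWeight k u i))]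
  by_cases hi : k i = 0
  · simp [interceptWeight, hi]
  · exact mul_le_mul_of_nonneg_right (hv i hi) (sq_nonneg _)

end LeastSquares

/-- Taylor's formula with Peano remainder. The derivative of `g` minus its quadratic polynomial is
o(|y - t|), because `deriv g` is differentiable at `t`; the mean value inequality on the closed ball
of radius |x - t| integrates this bound. -/
theorem eventually_abs_taylor_two_le {g : ℝ → ℝ} {t : ℝ} (hg : ContDiffAt ℝ 2 g t) {η : ℝ}
    (hη : 0 < η) :
    ∀ᶠ x in 𝓝 t, |g x - g t - deriv g t * (x - t) - iteratedDeriv 2 g t / 2 * (x - t) ^ 2| ≤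
      η * (x - t) ^ 2 := by
  have hdiff : ∀ᶠ x in 𝓝 t, DifferentiableAt ℝ g x := by
    have := (hg.eventually (by simp)).mono fun x hx => hx.differentiableAt (by norm_num)
    exact this
  have hd2 : DifferentiableAt ℝ (deriv g) t := by
    have h1 : ContDiffAt ℝ 1 (deriv g) t := hg.derivWithin (by norm_num)
    exact h1.differentiableAt (by norm_num)
  have hd2' : HasDerivAt (deriv g) (iteratedDeriv 2 g t) t := by
    rw [iteratedDeriv_succ, iteratedDeriv_one]
    exact hd2.hasDerivAt
  have hlo := (hasDerivAt_iff_isLittleO.1 hd2').def hη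
  obtain ⟨δ, hδ, hball⟩ := Metric.eventually_nhds_iff_ball.1 (hdiff.and hlo)
  refine Metric.eventually_nhds_iff_ball.2 ⟨δ, hδ, fun x hx => ?_⟩
  set r := dist x t with hr
  have hsub : Metric.closedBall t r ⊆ Metric.ball t δ := Metric.closedBall_subset_ball hx
  have hmv := (convex_closedBall t r).norm_image_sub_le_of_norm_hasDerivWithin_le
    (f := fun y => g y - deriv g t * (y - t) - iteratedDeriv 2 g t / 2 * (y - t) ^ 2)
    (f' := fun y => deriv g y - deriv g t * 1 - iteratedDeriv 2 g t / 2 * (2 * (y - t)))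
    (C := η * r) (x := t) (y := x) (fun y hy => ?_) (fun y hy => ?_)
    (Metric.mem_closedBall_self dist_nonneg) (Metric.mem_closedBall.2 le_rfl)
  · rw [Real.norm_eq_abs, Real.norm_eq_abs] at hmv
    rw [Real.dist_eq] at hr
    rw [hr, mul_assoc, abs_mul_abs_self] at hmv
    refine le_trans (le_of_eq ?_) (hmv.trans (le_of_eq (by ring)))
    congr 1
    ring
  · have h1 := (hball y (hsub hy)).1.hasDerivAt
    have h2 : HasDerivAt (fun y : ℝ => y - t) 1 y := (hasDerivAt_id y).sub_const t
    have h3 : HasDerivAt (fun y : ℝ => (y - t) ^ 2) (2 * (y - t)) y := by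
      have := h2.fun_pow 2
      simpa using! this
    exact ((h1.sub (h2.const_mul _)).sub (h3.const_mul _)).hasDerivWithinAt
  · have h1 := (hball y (hsub hy)).2
    rw [Real.norm_eq_abs, Real.norm_eq_abs, smul_eq_mul] at h1
    rw [Real.norm_eq_abs]
    calc |deriv g y - deriv g t * 1 - iteratedDeriv 2 g t / 2 * (2 * (y - t))|
        = |deriv g y - deriv g t - (y - t) * iteratedDeriv 2 g t| := by congr 1; ring
      _ ≤ η * |y - t| := h1
      _ ≤ η * r := by
        gcongr
        exact Metric.mem_closedBall.1 hy

/-- The constant in the bias of a local linear intercept, from the moments of the weights. -/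
def biasConst (n : ℕ → ℝ) : ℝ := (n 2 ^ 2 - n 1 * n 3) / (n 0 * n 2 - n 1 ^ 2)

/-- The constant in the variance of a local linear intercept, from the moments of the weights and
of their squares. -/
def varConst (n s : ℕ → ℝ) : ℝ :=
  (n 2 ^ 2 * s 0 - 2 * n 1 * n 2 * s 1 + n 1 ^ 2 * s 2) / (n 0 * n 2 - n 1 ^ 2) ^ 2

/-! ### Limits of the bias and variance of one arm along a random bandwidth -/

section Arm

variable {Ω : Type*} {X Z : ℕ → Ω → ℝ} {K : ℝ → ℝ} {t : ℝ} {b : Bool}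

/-- Lets the law of large numbers act on the least squares formulas: every moment carries one factor
N h, so these cancel in the bias and leave one in the variance. -/
theorem wMoment_armWeight (h : ℝ) (N : ℕ) (ω : Ω) (j : ℕ) (hh : (N * h : ℝ) ≠ 0) :
    wMoment (armWeight K t h (design X Z N ω) b) (scaled t h (design X Z N ω)) j =
      N * h * localAverage t X Z b (fun u => u ^ j * K u) h N ω := by
  rw [localAverage, mul_div_cancel₀ _ hh, wMoment]
  refine Finset.sum_congr rfl fun i _ => ?_
  simp only [armWeight, design, scaled]
  by_cases hi : Z i ω = 1 ↔ b = true
  · simp only [hi, if_true]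
    ring
  · simp only [hi, if_false]
    ring

theorem wMoment_armWeight_sq (h : ℝ) (N : ℕ) (ω : Ω) (j : ℕ) (hh : (N * h : ℝ) ≠ 0) :
    wMoment (fun i => armWeight K t h (design X Z N ω) b i ^ 2)
        (scaled t h (design X Z N ω)) j =
      N * h * localAverage t X Z b (fun u => u ^ j * K u ^ 2) h N ω := by
  rw [localAverage, mul_div_cancel₀ _ hh, wMoment]
  refine Finset.sum_congr rfl fun i _ => ?_
  simp only [armWeight, design, scaled]
  by_cases hi : Z i ω = 1 ↔ b = true
  · simp only [hi, if_true]
    ring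
  · simp only [hi, if_false]
    ring

theorem wDet_armWeight (h : ℝ) (N : ℕ) (ω : Ω) (hh : (N * h : ℝ) ≠ 0) :
    wDet (armWeight K t h (design X Z N ω) b) (scaled t h (design X Z N ω)) =
      (N * h) ^ 2 * (localAverage t X Z b (fun u => u ^ 0 * K u) h N ω *
        localAverage t X Z b (fun u => u ^ 2 * K u) h N ω -
        localAverage t X Z b (fun u => u ^ 1 * K u) h N ω ^ 2) := by
  rw [wDet, wMoment_armWeight _ _ _ _ hh, wMoment_armWeight _ _ _ _ hh,
    wMoment_armWeight _ _ _ _ hh]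
  ring

variable [MeasurableSpace Ω] {P : Measure Ω} {H : ℕ → Ω → ℝ} {f : ℝ} {n s : ℕ → ℝ}

theorem eventually_mul_pos (hH : ∀ᶠ q in probFilter P, 0 < H q.1 q.2) :
    ∀ᶠ q : ℕ × Ω in probFilter P, 0 < (q.1 * H q.1 q.2 : ℝ) := by
  filter_upwards [hH, tendsto_fst_probFilter.eventually (eventually_gt_atTop 0)] with q h1 h2
  have : (0 : ℝ) < q.1 := by exact_mod_cast h2
  positivity

theorem tendsto_localDet
    (hS : ∀ j, Tendsto (fun q : ℕ × Ω => localAverage t X Z b (fun u => u ^ j * K u)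
      (H q.1 q.2) q.1 q.2) (probFilter P) (𝓝 (f * n j))) :
    Tendsto (fun q : ℕ × Ω => localAverage t X Z b (fun u => u ^ 0 * K u) (H q.1 q.2) q.1 q.2 *
        localAverage t X Z b (fun u => u ^ 2 * K u) (H q.1 q.2) q.1 q.2 -
        localAverage t X Z b (fun u => u ^ 1 * K u) (H q.1 q.2) q.1 q.2 ^ 2) (probFilter P)
      (𝓝 (f ^ 2 * (n 0 * n 2 - n 1 ^ 2))) := by
  have := ((hS 0).mul (hS 2)).sub ((hS 1).pow 2)
  convert this using 2
  ring

theorem eventually_wDet_pos (hf : 0 < f) (hdet : 0 < n 0 * n 2 - n 1 ^ 2)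
    (hH : ∀ᶠ q in probFilter P, 0 < H q.1 q.2)
    (hS : ∀ j, Tendsto (fun q : ℕ × Ω => localAverage t X Z b (fun u => u ^ j * K u)
      (H q.1 q.2) q.1 q.2) (probFilter P) (𝓝 (f * n j))) :
    ∀ᶠ q : ℕ × Ω in probFilter P, 0 < wDet (armWeight K t (H q.1 q.2) (design X Z q.1 q.2) b)
      (scaled t (H q.1 q.2) (design X Z q.1 q.2)) := by
  filter_upwards [(tendsto_localDet hS).eventually_const_lt (by positivity),
    eventually_mul_pos hH] with q h1 h2
  rw [wDet_armWeight _ _ _ h2.ne']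
  positivity

theorem armWeight_nonneg (hK : ∀ u, 0 ≤ K u) {N : ℕ} (h : ℝ) (d : Fin N → ℝ × ℝ) (i : Fin N) :
    0 ≤ armWeight K t h d b i := by
  rw [armWeight]
  split_ifs <;> simp [hK]

theorem abs_scaled_le_of_armWeight_ne_zero (hK : ∀ u, 1 < |u| → K u = 0) {N : ℕ} {h : ℝ}
    {d : Fin N → ℝ × ℝ} {i : Fin N} (hi : armWeight K t h d b i ≠ 0) : |scaled t h d i| ≤ 1 := by
  by_contra hc
  push Not at hc
  apply hi
  rw [armWeight, show ((d i).1 - t) / h = scaled t h d i from rfl, hK _ hc]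
  simp

/-- Subjects with a positive weight are eventually in any neighbourhood of the threshold. -/
theorem eventually_forall_armWeight (hK : ∀ u, 1 < |u| → K u = 0)
    (hH : ∀ᶠ q in probFilter P, 0 < H q.1 q.2)
    (hH0 : Tendsto (fun q : ℕ × Ω => H q.1 q.2) (probFilter P) (𝓝 0)) {p : ℝ → Prop}
    (hp : ∀ᶠ x in 𝓝 t, p x) :
    ∀ᶠ q : ℕ × Ω in probFilter P, ∀ i, armWeight K t (H q.1 q.2) (design X Z q.1 q.2) b i ≠ 0 →
      p (X i q.2) := by
  obtain ⟨δ, hδ, hball⟩ := Metric.eventually_nhds_iff.1 hp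
  filter_upwards [hH, hH0.eventually_lt_const hδ] with q h1 h2 i hi
  apply hball
  have := abs_scaled_le_of_armWeight_ne_zero hK hi
  rw [scaled, abs_div, abs_of_pos h1, div_le_one h1] at this
  exact lt_of_le_of_lt this h2

/-- The leading term converges with the local moments. The Taylor error is any prescribed η times a
ratio of local moments that converges, so `tendsto_of_forall_abs_sub_le` removes it. -/
theorem tendsto_arm_bias (hK0 : ∀ u, 0 ≤ K u) (hK : ∀ u, 1 < |u| → K u = 0)
    (hf : 0 < f) (hdet : 0 < n 0 * n 2 - n 1 ^ 2)
    (hH : ∀ᶠ q in probFilter P, 0 < H q.1 q.2)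
    (hH0 : Tendsto (fun q : ℕ × Ω => H q.1 q.2) (probFilter P) (𝓝 0))
    (hS : ∀ j, Tendsto (fun q : ℕ × Ω => localAverage t X Z b (fun u => u ^ j * K u)
      (H q.1 q.2) q.1 q.2) (probFilter P) (𝓝 (f * n j)))
    {g : ℝ → ℝ} (hg : ContDiffAt ℝ 2 g t) :
    Tendsto (fun q : ℕ × Ω => (∑ i : Fin q.1,
        interceptWeight (armWeight K t (H q.1 q.2) (design X Z q.1 q.2) b)
          (scaled t (H q.1 q.2) (design X Z q.1 q.2)) i * g (X i q.2) - g t) / H q.1 q.2 ^ 2)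
      (probFilter P) (𝓝 (iteratedDeriv 2 g t / 2 * biasConst n)) := by
  set S : ℕ → ℕ × Ω → ℝ := fun j q =>
    localAverage t X Z b (fun u => u ^ j * K u) (H q.1 q.2) q.1 q.2 with hSdef
  have hD := tendsto_localDet hS
  have hD0 : f ^ 2 * (n 0 * n 2 - n 1 ^ 2) ≠ 0 := by positivity
  have hB : Tendsto (fun q : ℕ × Ω => iteratedDeriv 2 g t / 2 *
      ((S 2 q ^ 2 - S 1 q * S 3 q) / (S 0 q * S 2 q - S 1 q ^ 2))) (probFilter P)
      (𝓝 (iteratedDeriv 2 g t / 2 * biasConst n)) := by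
    have := ((((hS 2).pow 2).sub ((hS 1).mul (hS 3))).div hD hD0).const_mul
      (iteratedDeriv 2 g t / 2)
    rw [show biasConst n = ((f * n 2) ^ 2 - f * n 1 * (f * n 3)) /
      (f ^ 2 * (n 0 * n 2 - n 1 ^ 2)) by rw [biasConst]; field_simp]
    exact this
  have hC := (((hS 2).add (hS 1).abs).mul (hS 2)).div hD hD0
  refine tendsto_of_forall_abs_sub_le hB hC fun η hη => ?_
  filter_upwards [eventually_wDet_pos hf hdet hH hS, eventually_mul_pos hH, hH,
    eventually_forall_armWeight (b := b) (X := X) (Z := Z) hK hH hH0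
      (eventually_abs_taylor_two_le hg hη)] with q h1 h2 h3 h4
  have hx : ∀ i : Fin q.1, H q.1 q.2 * scaled t (H q.1 q.2) (design X Z q.1 q.2) i =
      X i q.2 - t := fun i => by
    simp only [scaled, design]; field_simp
  have key := abs_sum_interceptWeight_mul_sub_le (g := fun i : Fin q.1 => g (X i q.2))
    (a₀ := g t) (a₁ := deriv g t) (c := iteratedDeriv 2 g t / 2) (η := η) (h := H q.1 q.2)
    (armWeight_nonneg hK0 _ _) h1 (fun i hi => abs_scaled_le_of_armWeight_ne_zero hK hi)
    (fun i hi => by rw [hx i]; exact h4 i hi)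
  have hm : ∀ j, wMoment (armWeight K t (H q.1 q.2) (design X Z q.1 q.2) b)
      (scaled t (H q.1 q.2) (design X Z q.1 q.2)) j = q.1 * H q.1 q.2 * S j q :=
    fun j => wMoment_armWeight _ _ _ j h2.ne'
  have hdt : wDet (armWeight K t (H q.1 q.2) (design X Z q.1 q.2) b)
      (scaled t (H q.1 q.2) (design X Z q.1 q.2)) =
      (q.1 * H q.1 q.2) ^ 2 * (S 0 q * S 2 q - S 1 q ^ 2) := wDet_armWeight _ _ _ h2.ne'
  rw [sum_interceptWeight_mul_pow, hdt, hm 1, hm 2, hm (2 + 1), abs_mul, abs_of_pos h2] at key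
  rw [hdt] at h1
  set M : ℝ := q.1 * H q.1 q.2 with hM
  have hSd : 0 < S 0 q * S 2 q - S 1 q ^ 2 := by
    by_contra hc
    push Not at hc
    have := mul_nonpos_of_nonneg_of_nonpos (sq_nonneg M) hc
    linarith
  set Dt := S 0 q * S 2 q - S 1 q ^ 2 with hDt
  have hHsq : 0 < H q.1 q.2 ^ 2 := by positivity
  have e1 : (M * S 2 q * (M * S 2 q) - M * S 1 q * (M * S (2 + 1) q)) / (M ^ 2 * Dt) =
      (S 2 q ^ 2 - S 1 q * S 3 q) / Dt := by
    field_simp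
  have e2 : (M * S 2 q + M * |S 1 q|) * (M * S 2 q) / (M ^ 2 * Dt) =
      (S 2 q + |S 1 q|) * S 2 q / Dt := by
    field_simp
  rw [e1, e2] at key
  refine le_of_mul_le_mul_left (le_trans (le_of_eq ?_) key) hHsq
  rw [← abs_of_pos hHsq, ← abs_mul, abs_of_pos hHsq]
  congr 1
  field_simp

/-- All subjects with weight have conditional variance close to `v t` by continuity, and the sum of
squared weights is 1/(N H) times a convergent ratio of local moments. -/
theorem tendsto_arm_variance (hK : ∀ u, 1 < |u| → K u = 0)
    (hf : 0 < f) (hdet : 0 < n 0 * n 2 - n 1 ^ 2)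
    (hH : ∀ᶠ q in probFilter P, 0 < H q.1 q.2)
    (hH0 : Tendsto (fun q : ℕ × Ω => H q.1 q.2) (probFilter P) (𝓝 0))
    (hS : ∀ j, Tendsto (fun q : ℕ × Ω => localAverage t X Z b (fun u => u ^ j * K u)
      (H q.1 q.2) q.1 q.2) (probFilter P) (𝓝 (f * n j)))
    (hQ : ∀ j, Tendsto (fun q : ℕ × Ω => localAverage t X Z b (fun u => u ^ j * K u ^ 2)
      (H q.1 q.2) q.1 q.2) (probFilter P) (𝓝 (f * s j)))
    {v : ℝ → ℝ} (hv : ContinuousAt v t) :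
    Tendsto (fun q : ℕ × Ω => q.1 * H q.1 q.2 * ∑ i : Fin q.1,
        interceptWeight (armWeight K t (H q.1 q.2) (design X Z q.1 q.2) b)
          (scaled t (H q.1 q.2) (design X Z q.1 q.2)) i ^ 2 * v (X i q.2))
      (probFilter P) (𝓝 (v t * (varConst n s / f))) := by
  set S : ℕ → ℕ × Ω → ℝ := fun j q =>
    localAverage t X Z b (fun u => u ^ j * K u) (H q.1 q.2) q.1 q.2 with hSdef
  set Q : ℕ → ℕ × Ω → ℝ := fun j q =>
    localAverage t X Z b (fun u => u ^ j * K u ^ 2) (H q.1 q.2) q.1 q.2 with hQdef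
  have hD := tendsto_localDet hS
  have hD0 : f ^ 2 * (n 0 * n 2 - n 1 ^ 2) ≠ 0 := by positivity
  have hC : Tendsto (fun q : ℕ × Ω => (S 2 q ^ 2 * Q 0 q - 2 * S 1 q * S 2 q * Q 1 q +
      S 1 q ^ 2 * Q 2 q) / (S 0 q * S 2 q - S 1 q ^ 2) ^ 2) (probFilter P)
      (𝓝 (varConst n s / f)) := by
    have := ((((hS 2).pow 2).mul (hQ 0)).sub ((((hS 1).const_mul 2).mul (hS 2)).mul (hQ 1))
      |>.add (((hS 1).pow 2).mul (hQ 2))).div (hD.pow 2) (pow_ne_zero 2 hD0)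
    rw [show varConst n s / f = ((f * n 2) ^ 2 * (f * s 0) - 2 * (f * n 1) * (f * n 2) * (f * s 1) +
      (f * n 1) ^ 2 * (f * s 2)) / (f ^ 2 * (n 0 * n 2 - n 1 ^ 2)) ^ 2 by rw [varConst]; field_simp]
    exact this
  refine tendsto_of_forall_abs_sub_le (hC.const_mul (v t)) hC fun η hη => ?_
  have hvη : ∀ᶠ x in 𝓝 t, |v x - v t| ≤ η := by
    filter_upwards [Metric.tendsto_nhds.1 hv η hη] with x hx
    exact (Real.dist_eq _ _ ▸ hx).le
  filter_upwards [eventually_wDet_pos hf hdet hH hS, eventually_mul_pos hH,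
    eventually_forall_armWeight (b := b) (X := X) (Z := Z) hK hH hH0 hvη] with q h1 h2 h4
  have key := abs_sum_interceptWeight_sq_mul_sub_le (v := fun i : Fin q.1 => v (X i q.2))
    (u := scaled t (H q.1 q.2) (design X Z q.1 q.2)) h4
  have hm : ∀ j, wMoment (armWeight K t (H q.1 q.2) (design X Z q.1 q.2) b)
      (scaled t (H q.1 q.2) (design X Z q.1 q.2)) j = q.1 * H q.1 q.2 * S j q :=
    fun j => wMoment_armWeight _ _ _ j h2.ne'
  have hq : ∀ j, wMoment (fun i => armWeight K t (H q.1 q.2) (design X Z q.1 q.2) b i ^ 2)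
      (scaled t (H q.1 q.2) (design X Z q.1 q.2)) j = q.1 * H q.1 q.2 * Q j q :=
    fun j => wMoment_armWeight_sq _ _ _ j h2.ne'
  have hdt : wDet (armWeight K t (H q.1 q.2) (design X Z q.1 q.2) b)
      (scaled t (H q.1 q.2) (design X Z q.1 q.2)) =
      (q.1 * H q.1 q.2) ^ 2 * (S 0 q * S 2 q - S 1 q ^ 2) := wDet_armWeight _ _ _ h2.ne'
  have hsum := sum_interceptWeight_sq (armWeight K t (H q.1 q.2) (design X Z q.1 q.2) b)
    (scaled t (H q.1 q.2) (design X Z q.1 q.2))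
  rw [hdt, hm 1, hm 2, hq 0, hq 1, hq 2] at hsum
  rw [hdt] at h1
  set M : ℝ := q.1 * H q.1 q.2 with hM
  have hSd : S 0 q * S 2 q - S 1 q ^ 2 ≠ 0 := fun hc => by simp [hc] at h1
  set Dt := S 0 q * S 2 q - S 1 q ^ 2 with hDt
  have e1 : M * ∑ i, interceptWeight (armWeight K t (H q.1 q.2) (design X Z q.1 q.2) b)
      (scaled t (H q.1 q.2) (design X Z q.1 q.2)) i ^ 2 =
      (S 2 q ^ 2 * Q 0 q - 2 * S 1 q * S 2 q * Q 1 q + S 1 q ^ 2 * Q 2 q) / Dt ^ 2 := by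
    rw [hsum]
    field_simp
  rw [← e1]
  have := mul_le_mul_of_nonneg_left key h2.le
  rw [← abs_of_pos h2, ← abs_mul, abs_of_pos h2] at this
  refine le_trans (le_of_eq ?_) (this.trans (le_of_eq (by ring)))
  congr 1
  ring

end Arm

/-! ### The limit of the rescaled mean squared error -/

theorem IsSmoothingKernel.measurable {K : ℝ → ℝ} (hK : IsSmoothingKernel K) : Measurable K := by
  have h : K = Set.indicator (Set.Icc (-1) 1) K := by
    ext u
    by_cases hu : u ∈ Set.Icc (-1 : ℝ) 1
    · rw [Set.indicator_of_mem hu]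
    · rw [Set.indicator_of_notMem hu, hK.support u (not_le.1 fun hc => hu (abs_le.1 hc))]
  classical
  rw [h, ← Set.piecewise_eq_indicator]
  exact hK.continuousOn.measurable_piecewise continuousOn_const measurableSet_Icc

theorem IsSmoothingKernel.isProfile {K : ℝ → ℝ} (hK : IsSmoothingKernel K) : IsProfile K := by
  obtain ⟨B, hB⟩ := hK.bounded
  exact ⟨hK.measurable, ⟨B, fun u => by rw [abs_of_nonneg (hK.nonneg u)]; exact hB u⟩,
    hK.support, hK.continuousOn⟩

theorem IsProfile.pow_mul {ψ : ℝ → ℝ} (h : IsProfile ψ) (j : ℕ) :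
    IsProfile fun u => u ^ j * ψ u := by
  obtain ⟨B, hB⟩ := h.bounded
  have hB0 : 0 ≤ B := (abs_nonneg _).trans (hB 0)
  refine ⟨(measurable_id.pow_const j).mul h.measurable, ⟨B, fun u => ?_⟩,
    fun u hu => by rw [h.support u hu, mul_zero],
    (continuous_pow j).continuousOn.mul h.continuousOn⟩
  by_cases hu : 1 < |u|
  · rw [h.support u hu, mul_zero, abs_zero]
    exact hB0
  · rw [abs_mul, abs_pow]
    calc |u| ^ j * |ψ u| ≤ 1 * B :=
          mul_le_mul (pow_le_one₀ (abs_nonneg u) (not_lt.1 hu)) (hB u) (abs_nonneg _) zero_le_one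
      _ = B := one_mul B

theorem IsProfile.sq {ψ : ℝ → ℝ} (h : IsProfile ψ) : IsProfile fun u => ψ u ^ 2 := by
  obtain ⟨B, hB⟩ := h.isTest.sq.bounded
  exact ⟨h.measurable.pow_const 2, ⟨B, hB⟩, fun u hu => by rw [h.support u hu]; simp,
    h.continuousOn.pow 2⟩

theorem tendsto_rpow_neg_fifth : Tendsto (fun N : ℕ => (N : ℝ) ^ (-(1 / 5) : ℝ)) atTop (𝓝 0) :=
  (tendsto_rpow_neg_atTop (by norm_num : (0 : ℝ) < 1 / 5)).comp tendsto_natCast_atTop_atTop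

theorem mul_rpow_neg_fifth {x : ℝ} (hx : 0 < x) : x * x ^ (-(1 / 5) : ℝ) = x ^ (4 / 5 : ℝ) := by
  rw [← Real.rpow_one_add' hx.le (by norm_num)]
  norm_num

theorem Superpopulation.IsRegularAt.continuousAt_density {pop : Superpopulation} {t : ℝ}
    (hreg : pop.IsRegularAt t) : ContinuousAt pop.density t :=
  hreg.density_differentiable.self_of_nhds.continuousAt

section Experiment

variable {Ω : Type*} [MeasurableSpace Ω] {P : Measure Ω} [IsProbabilityMeasure P]
  {pop : Superpopulation} {e : ℝ → ℝ} {X Yp Ym Z : ℕ → Ω → ℝ}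

/-- The design enters only through the limit profiles `w b`. With H = G N^(-1/5), the squared bias
is of order H⁴ and the variance of order 1/(N H); both are of order N^(-4/5). -/
theorem IsExperiment.tendsto_condMSE (hE : IsExperiment P pop e X Yp Ym Z) (he : Measurable e)
    (he0 : ∀ x, 0 ≤ e x) (he1 : ∀ x, e x ≤ 1) {t : ℝ} (hreg : pop.IsRegularAt t)
    {K : ℝ → ℝ} (hK : IsSmoothingKernel K) {w : Bool → ℝ → ℝ} (hw : ∀ b, Measurable (w b))
    (hw0 : ∀ b u, 0 ≤ w b u) (hw1 : ∀ b u, w b u ≤ 1)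
    (hlim : ∀ b, ∀ᵐ u, Tendsto (fun h => armProb e b (t + h * u)) (𝓝[>] 0) (𝓝 (w b u)))
    {n s : Bool → ℕ → ℝ} (hn : ∀ b j, n b j = ∫ u, u ^ j * K u * w b u)
    (hs : ∀ b j, s b j = ∫ u, u ^ j * K u ^ 2 * w b u)
    (hdet : ∀ b, 0 < n b 0 * n b 2 - n b 1 ^ 2) {a : ℝ} (ha : 0 < a) {G : ℕ → Ω → ℝ}
    (hG : Tendsto (fun q : ℕ × Ω => G q.1 q.2) (probFilter P) (𝓝 a)) :
    Tendsto (fun q : ℕ × Ω => (q.1 : ℝ) ^ (4 / 5 : ℝ) *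
        condMSE P pop K t X Yp Ym Z (G q.1 q.2 * (q.1 : ℝ) ^ (-(1 / 5) : ℝ)) q.1 q.2)
      (probFilter P)
      (𝓝 (a ^ 4 * (iteratedDeriv 2 pop.meanPlus t / 2 * biasConst (n true) -
          iteratedDeriv 2 pop.meanMinus t / 2 * biasConst (n false)) ^ 2 +
        (pop.varPlus t * (varConst (n true) (s true) / pop.density t) +
          pop.varMinus t * (varConst (n false) (s false) / pop.density t)) / a)) := by
  have hf := hreg.continuousAt_density
  have hNpos : ∀ᶠ N : ℕ in atTop, 0 < (N : ℝ) := by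
    filter_upwards [eventually_gt_atTop 0] with N hN
    exact_mod_cast hN
  set H : ℕ → Ω → ℝ := fun N ω => G N ω * (N : ℝ) ^ (-(1 / 5) : ℝ) with hHdef
  set h : ℕ → ℝ := fun N => a * (N : ℝ) ^ (-(1 / 5) : ℝ) with hhdef
  have hpos : ∀ᶠ N in atTop, 0 < h N := by
    filter_upwards [hNpos] with N hN
    positivity
  have h0 : Tendsto h atTop (𝓝 0) := by
    have := tendsto_rpow_neg_fifth.const_mul a
    rwa [mul_zero] at this
  have hNh : Tendsto (fun N => N * h N) atTop atTop := by
    have h1 : Tendsto (fun N : ℕ => a * (N : ℝ) ^ (4 / 5 : ℝ)) atTop atTop :=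
      ((tendsto_rpow_atTop (by norm_num)).comp tendsto_natCast_atTop_atTop).const_mul_atTop ha
    refine h1.congr' ?_
    filter_upwards [hNpos] with N hN
    rw [hhdef, ← mul_rpow_neg_fifth hN]
    ring
  have hNposL : ∀ᶠ q : ℕ × Ω in probFilter P, 0 < (q.1 : ℝ) :=
    tendsto_fst_probFilter.eventually hNpos
  have hHh : Tendsto (fun q : ℕ × Ω => H q.1 q.2 / h q.1) (probFilter P) (𝓝 1) := by
    have h1 := hG.div_const a
    rw [div_self ha.ne'] at h1
    refine h1.congr' ?_
    filter_upwards [hNposL] with q hq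
    have : (0 : ℝ) < (q.1 : ℝ) ^ (-(1 / 5) : ℝ) := by positivity
    simp only [hHdef, hhdef]
    rw [mul_div_mul_right _ _ this.ne']
  have hGpos : ∀ᶠ q : ℕ × Ω in probFilter P, 0 < G q.1 q.2 := hG.eventually_const_lt ha
  have hH : ∀ᶠ q : ℕ × Ω in probFilter P, 0 < H q.1 q.2 := by
    filter_upwards [hNposL, hGpos] with q h1 h2
    simp only [hHdef]
    positivity
  have hH0 : Tendsto (fun q : ℕ × Ω => H q.1 q.2) (probFilter P) (𝓝 0) := by
    have := hG.mul (tendsto_rpow_neg_fifth.comp (tendsto_fst_probFilter (P := P)))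
    rw [mul_zero] at this
    exact this
  have hS : ∀ b j, Tendsto (fun q : ℕ × Ω => localAverage t X Z b (fun u => u ^ j * K u)
      (H q.1 q.2) q.1 q.2) (probFilter P) (𝓝 (pop.density t * n b j)) := by
    intro b j
    rw [hn]
    exact hE.tendsto_localAverage_random he he0 he1 hf (hw b) (hw0 b) (hw1 b) (hlim b)
      (hK.isProfile.pow_mul j) hpos h0 hNh hHh
  have hQ : ∀ b j, Tendsto (fun q : ℕ × Ω => localAverage t X Z b (fun u => u ^ j * K u ^ 2)
      (H q.1 q.2) q.1 q.2) (probFilter P) (𝓝 (pop.density t * s b j)) := by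
    intro b j
    rw [hs]
    exact hE.tendsto_localAverage_random he he0 he1 hf (hw b) (hw0 b) (hw1 b) (hlim b)
      (hK.isProfile.sq.pow_mul j) hpos h0 hNh hHh
  have hsm : ∀ b, ContDiffAt ℝ 2 (armMean pop b) t := by
    intro b
    cases b
    · exact hreg.meanMinus_contDiff.of_le (by norm_num)
    · exact hreg.meanPlus_contDiff.of_le (by norm_num)
  have hvc : ∀ b, ContinuousAt (armVar pop b) t := by
    intro b
    cases b
    · exact hreg.varMinus_continuous
    · exact hreg.varPlus_continuous
  have hmem : ∀ b, ∀ᶠ x in 𝓝 t, MemLp (armOutcome b) 2 (pop.cond x) := by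
    intro b
    cases b
    · exact hreg.memLp_minus
    · exact hreg.memLp_plus
  have hbias := fun b => tendsto_arm_bias (b := b) hK.nonneg hK.support hreg.density_pos (hdet b) hH
    hH0 (hS b) (hsm b)
  have hvar := fun b => tendsto_arm_variance (b := b) hK.support hreg.density_pos (hdet b) hH
    hH0 (hS b) (hQ b) (hvc b)
  have hfinal := ((hG.pow 4).mul (((hbias true).sub (hbias false)).pow 2)).add
    (((hvar true).add (hvar false)).div hG ha.ne')
  refine Tendsto.congr' ?_ hfinal
  have hcond : ∀ᶠ q : ℕ × Ω in probFilter P,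
      condDistrib (observed Yp Ym Z q.1) (design X Z q.1) P (design X Z q.1 q.2) =
        Measure.pi fun i => outcomeKernel pop (design X Z q.1 q.2 i) :=
    eventually_probFilter_of_ae fun N => hE.condDistrib_ae_eq he he0 he1 N
  filter_upwards [hcond, hNposL, hGpos, hH,
    eventually_wDet_pos hreg.density_pos (hdet true) hH (hS true),
    eventually_wDet_pos hreg.density_pos (hdet false) hH (hS false),
    eventually_forall_armWeight (b := true) (X := X) (Z := Z) hK.support hH hH0 (hmem true),
    eventually_forall_armWeight (b := false) (X := X) (Z := Z) hK.support hH hH0 (hmem false)]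
    with q h1 h2 h3 h4 h5 h6 h7 h8
  rw [hE.condMSE_eq hK.nonneg h1 h4.ne' (fun b => by cases b; exacts [h6, h5])
    (fun b => by cases b; exacts [h8, h7])]
  have hτ : pop.tauThresh t = armMean pop true t - armMean pop false t := rfl
  rw [hτ]
  have hx : (0 : ℝ) < (q.1 : ℝ) ^ (-(1 / 5) : ℝ) := by positivity
  have hr : (q.1 : ℝ) ^ (4 / 5 : ℝ) = q.1 * (q.1 : ℝ) ^ (-(1 / 5) : ℝ) := (mul_rpow_neg_fifth h2).symm
  have hfive : (q.1 : ℝ) * ((q.1 : ℝ) ^ (-(1 / 5) : ℝ)) ^ 5 = 1 := by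
    rw [← Real.rpow_natCast, ← Real.rpow_mul h2.le]
    norm_num
    rw [Real.rpow_neg_one, mul_inv_cancel₀ h2.ne']
  rw [hr]
  simp only [hHdef, Pi.div_apply] at h4 ⊢
  set ρ : ℝ := (q.1 : ℝ) ^ (-(1 / 5) : ℝ) with hρ
  set Bp := ∑ i : Fin q.1, interceptWeight (armWeight K t (G q.1 q.2 * ρ) (design X Z q.1 q.2) true)
    (scaled t (G q.1 q.2 * ρ) (design X Z q.1 q.2)) i * armMean pop true (X i q.2)
  set Bm := ∑ i : Fin q.1, interceptWeight (armWeight K t (G q.1 q.2 * ρ) (design X Z q.1 q.2) false)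
    (scaled t (G q.1 q.2 * ρ) (design X Z q.1 q.2)) i * armMean pop false (X i q.2)
  set Vp := ∑ i : Fin q.1, interceptWeight (armWeight K t (G q.1 q.2 * ρ) (design X Z q.1 q.2) true)
    (scaled t (G q.1 q.2 * ρ) (design X Z q.1 q.2)) i ^ 2 * armVar pop true (X i q.2)
  set Vm := ∑ i : Fin q.1, interceptWeight (armWeight K t (G q.1 q.2 * ρ) (design X Z q.1 q.2) false)
    (scaled t (G q.1 q.2 * ρ) (design X Z q.1 q.2)) i ^ 2 * armVar pop false (X i q.2)
  -- Writing N as ρ^(-5) makes the comparison of the rescaled error with `hfinal` an identity of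
  -- rational functions.
  have hN : (q.1 : ℝ) = 1 / ρ ^ 5 := by
    rw [eq_div_iff (by positivity)]
    exact hfive
  rw [hN]
  field_simp
  ring

end Experiment

/-! ### The constants of the kernel -/

/-- The moments of a weight function. -/
def moment (m : ℝ → ℝ) (j : ℕ) : ℝ := ∫ u, u ^ j * m u

/-- The form is the integral of (a + b u)² m(u), and a nonzero affine function has at most one root,
so it cannot vanish wherever `m` has mass. It yields the positivity of the determinants and of the
variance constants. -/
theorem moment_quadratic_pos {m : ℝ → ℝ} (hm : ∀ u, 0 ≤ m u)
    (hi : ∀ j : ℕ, Integrable fun u => u ^ j * m u) (hpos : 0 < moment m 0) {a b : ℝ}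
    (hab : a ≠ 0 ∨ b ≠ 0) :
    0 < a ^ 2 * moment m 0 + 2 * a * b * moment m 1 + b ^ 2 * moment m 2 := by
  have hintg : ∫ u, (a + b * u) ^ 2 * m u =
      a ^ 2 * moment m 0 + 2 * a * b * moment m 1 + b ^ 2 * moment m 2 := by
    simp only [moment]
    have h01 : Integrable fun u => a ^ 2 * (u ^ 0 * m u) + 2 * a * b * (u ^ 1 * m u) :=
      ((hi 0).const_mul _).add ((hi 1).const_mul _)
    rw [← integral_const_mul, ← integral_const_mul, ← integral_const_mul,
      ← integral_add ((hi 0).const_mul _) ((hi 1).const_mul _),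
      ← integral_add h01 ((hi 2).const_mul _)]
    refine integral_congr_ae (ae_of_all _ fun u => ?_)
    simp only
    ring
  have hintg' : Integrable fun u => (a + b * u) ^ 2 * m u := by
    have := (((hi 0).const_mul (a ^ 2)).add ((hi 1).const_mul (2 * a * b))).add
      ((hi 2).const_mul (b ^ 2))
    refine this.congr (ae_of_all _ fun u => ?_)
    simp only [Pi.add_apply]
    ring
  have hnn : ∀ u, 0 ≤ (a + b * u) ^ 2 * m u := fun u => mul_nonneg (sq_nonneg _) (hm u)
  rw [← hintg]
  refine lt_of_le_of_ne (integral_nonneg hnn) fun h0 => ?_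
  have hae := (integral_eq_zero_iff_of_nonneg hnn hintg').1 h0.symm
  have hroot : ∀ᵐ u : ℝ, a + b * u ≠ 0 := by
    have hfin : Set.Subsingleton {u : ℝ | a + b * u = 0} := by
      intro x hx y hy
      simp only [Set.mem_ofPred_eq] at hx hy
      have hb : b ≠ 0 := by
        rintro rfl
        rcases hab with h | h
        · apply h; linarith
        · exact h rfl
      have : b * (x - y) = 0 := by linarith
      rcases mul_eq_zero.1 this with h | h
      · exact absurd h hb
      · linarith
    have := hfin.measure_zero (volume : Measure ℝ)
    rw [ae_iff]
    simpa using! this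
  have hz : moment m 0 = 0 := by
    rw [moment, integral_eq_zero_of_ae]
    filter_upwards [hae, hroot] with u h1 h2
    have h1' : (a + b * u) ^ 2 * m u = 0 := h1
    rcases mul_eq_zero.1 h1' with h | h
    · exact absurd (pow_eq_zero_iff two_ne_zero |>.1 h) h2
    · simp [h]
  linarith

theorem moment_det_pos {m : ℝ → ℝ} (hm : ∀ u, 0 ≤ m u)
    (hi : ∀ j : ℕ, Integrable fun u => u ^ j * m u) (hpos : 0 < moment m 0) :
    0 < moment m 0 * moment m 2 - moment m 1 ^ 2 := by
  -- At this vector the form equals the zeroth moment times the determinant.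
  have h := moment_quadratic_pos hm hi hpos (a := moment m 1) (b := -moment m 0)
    (Or.inr (neg_ne_zero.2 hpos.ne'))
  have : 0 < moment m 0 * (moment m 0 * moment m 2 - moment m 1 ^ 2) := by nlinarith
  exact pos_of_mul_pos_right this hpos.le

theorem IsSmoothingKernel.integrable {K : ℝ → ℝ} (hK : IsSmoothingKernel K) (j : ℕ)
    {w : ℝ → ℝ} (hw : Measurable w) (hw0 : ∀ u, 0 ≤ w u) (hw1 : ∀ u, w u ≤ 1) :
    Integrable fun u => u ^ j * (K u * w u) := by
  have := (hK.isProfile.pow_mul j).isTest.integrable_mul hw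
    (fun u => by rw [abs_of_nonneg (hw0 u)]; exact hw1 u)
  simpa only [mul_assoc] using this

theorem IsSmoothingKernel.integral_pos {K : ℝ → ℝ} (hK : IsSmoothingKernel K) :
    0 < moment K 0 := by
  have hi := hK.integrable 0 (w := fun _ => 1) measurable_const (by simp) (by simp)
  simp only [mul_one] at hi
  have hnn : ∀ u, 0 ≤ u ^ 0 * K u := fun u => by simpa using hK.nonneg u
  refine lt_of_le_of_ne (integral_nonneg hnn) fun h0 => ?_
  have hae := (integral_eq_zero_iff_of_nonneg hnn hi).1 h0.symm
  have hae' : K =ᵐ[volume.restrict (Set.Icc (-1) 1)] fun _ => 0 :=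
    ae_restrict_of_ae (hae.mono fun u hu => by simpa using hu)
  -- A function continuous on `[-1, 1]` and almost everywhere zero there vanishes at every point,
  -- endpoints included; so it does not matter where `K` is known to be positive.
  have heq := Measure.eqOn_Icc_of_ae_eq (volume : Measure ℝ) (by norm_num) hae' hK.continuousOn
    continuousOn_const
  obtain ⟨u, hu⟩ := hK.pos_somewhere
  by_cases h : 1 < |u|
  · rw [hK.support u h] at hu
    exact lt_irrefl _ hu
  · have h1 := heq (abs_le.1 (not_lt.1 h))
    simp only at h1
    linarith

theorem IsSmoothingKernel.sq {K : ℝ → ℝ} (hK : IsSmoothingKernel K) :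
    IsSmoothingKernel fun u => K u ^ 2 := by
  obtain ⟨B, hB⟩ := hK.bounded
  obtain ⟨u₀, hu₀⟩ := hK.pos_somewhere
  exact ⟨fun u => sq_nonneg _, fun u => by rw [hK.symmetric],
    ⟨B ^ 2, fun u => pow_le_pow_left₀ (hK.nonneg u) (hB u) 2⟩,
    fun u hu => by rw [hK.support u hu]; simp, hK.continuousOn.pow 2, ⟨u₀, by positivity⟩⟩

/-- The indicator of the half-line on which the regression discontinuity design treats. -/
def halfLine (u : ℝ) : ℝ := if 0 < u then 1 else 0

theorem measurable_halfLine : Measurable halfLine :=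
  Measurable.ite measurableSet_Ioi measurable_const measurable_const

theorem halfLine_nonneg (u : ℝ) : 0 ≤ halfLine u := by
  rw [halfLine]; split_ifs <;> norm_num

theorem halfLine_le_one (u : ℝ) : halfLine u ≤ 1 := by
  rw [halfLine]; split_ifs <;> norm_num

theorem moment_mul_halfLine (K : ℝ → ℝ) (j : ℕ) :
    moment (fun u => K u * halfLine u) j = ∫ u in Set.Ioi (0 : ℝ), u ^ j * K u := by
  rw [moment, ← integral_indicator measurableSet_Ioi]
  congr 1
  ext u
  by_cases hu : 0 < u
  · rw [Set.indicator_of_mem (show u ∈ Set.Ioi (0 : ℝ) from hu)]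
    simp [halfLine, hu]
  · rw [Set.indicator_of_notMem (show u ∉ Set.Ioi (0 : ℝ) from hu)]
    simp [halfLine, hu]

theorem moment_mul_one_sub_halfLine {K : ℝ → ℝ} (hK : ∀ u, K (-u) = K u) (j : ℕ) :
    moment (fun u => K u * (1 - halfLine u)) j =
      (-1) ^ j * moment (fun u => K u * halfLine u) j := by
  -- The endpoint is written `-0` to match the reflection formula for integrals over half-lines.
  have h1 : moment (fun u => K u * (1 - halfLine u)) j =
      ∫ u in Set.Iic (-0 : ℝ), u ^ j * K u := by
    rw [moment, ← integral_indicator measurableSet_Iic]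
    congr 1
    ext u
    by_cases hu : 0 < u
    · rw [Set.indicator_of_notMem (show u ∉ Set.Iic (-0 : ℝ) by simpa using hu)]
      simp [halfLine, hu]
    · rw [Set.indicator_of_mem (show u ∈ Set.Iic (-0 : ℝ) by simpa using hu)]
      simp [halfLine, hu]
  rw [h1, moment_mul_halfLine, ← integral_comp_neg_Ioi, ← integral_const_mul]
  refine setIntegral_congr_fun measurableSet_Ioi fun u _ => ?_
  change (-u) ^ j * K (-u) = (-1) ^ j * (u ^ j * K u)
  rw [hK, neg_pow u j]
  ring

theorem nuTilde_eq (K : ℝ → ℝ) : nuTilde K = moment fun u => K u * halfLine u :=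
  funext fun j => (moment_mul_halfLine K j).symm

theorem kpiTilde_eq (K : ℝ → ℝ) : kpiTilde K = moment fun u => K u ^ 2 * halfLine u :=
  funext fun j => (moment_mul_halfLine (fun u => K u ^ 2) j).symm

theorem IsSmoothingKernel.moment_halfLine_pos {K : ℝ → ℝ} (hK : IsSmoothingKernel K) :
    0 < moment (fun u => K u * halfLine u) 0 := by
  have h1 := moment_mul_one_sub_halfLine hK.symmetric 0
  have i1 := hK.integrable 0 measurable_halfLine halfLine_nonneg halfLine_le_one
  have i2 := hK.integrable 0 (w := fun u => 1 - halfLine u)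
    (measurable_const.sub measurable_halfLine) (fun u => sub_nonneg.2 (halfLine_le_one u))
    (fun u => sub_le_self _ (halfLine_nonneg u))
  have h2 : moment K 0 = moment (fun u => K u * halfLine u) 0 +
      moment (fun u => K u * (1 - halfLine u)) 0 := by
    simp only [moment]
    rw [← integral_add i1 i2]
    congr 1
    ext u
    ring
  rw [h1, pow_zero, one_mul] at h2
  linarith [hK.integral_pos]

theorem IsSmoothingKernel.nuTilde_det_pos {K : ℝ → ℝ} (hK : IsSmoothingKernel K) :
    0 < nuTilde K 0 * nuTilde K 2 - nuTilde K 1 ^ 2 := by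
  rw [nuTilde_eq]
  exact moment_det_pos (fun u => mul_nonneg (hK.nonneg u) (halfLine_nonneg u))
    (fun j => hK.integrable j measurable_halfLine halfLine_nonneg halfLine_le_one)
    hK.moment_halfLine_pos

theorem IsSmoothingKernel.nuTilde_two_pos {K : ℝ → ℝ} (hK : IsSmoothingKernel K) :
    0 < nuTilde K 2 := by
  have h := moment_quadratic_pos (fun u => mul_nonneg (hK.nonneg u) (halfLine_nonneg u))
    (fun j => hK.integrable j measurable_halfLine halfLine_nonneg halfLine_le_one)
    hK.moment_halfLine_pos (a := 0) (b := 1) (Or.inr one_ne_zero)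
  rw [nuTilde_eq]
  linarith

theorem IsSmoothingKernel.nuTilde_one_pos {K : ℝ → ℝ} (hK : IsSmoothingKernel K) :
    0 < nuTilde K 1 := by
  have hnn : 0 ≤ nuTilde K 1 := setIntegral_nonneg measurableSet_Ioi fun u hu =>
    mul_nonneg (pow_nonneg (le_of_lt hu) 1) (hK.nonneg u)
  have hle : nuTilde K 2 ≤ nuTilde K 1 := by
    rw [nuTilde_eq]
    refine integral_mono
      (hK.integrable 2 measurable_halfLine halfLine_nonneg halfLine_le_one)
      (hK.integrable 1 measurable_halfLine halfLine_nonneg halfLine_le_one) fun u => ?_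
    simp only
    by_cases hu : 1 < |u|
    · simp [hK.support u hu]
    by_cases h0 : 0 < u
    · have h1 : u ≤ 1 := (le_abs_self u).trans (not_lt.1 hu)
      refine mul_le_mul_of_nonneg_right ?_ (mul_nonneg (hK.nonneg u) (halfLine_nonneg u))
      nlinarith
    · simp [halfLine, h0]
  linarith [hK.nuTilde_two_pos]

/-- Strict Cauchy-Schwarz for the weight u K(u) on the positive half-line: its determinant is ν̃₁ν̃₃
- ν̃₂², the negative of the numerator. -/
theorem IsSmoothingKernel.biasConst_nuTilde_ne {K : ℝ → ℝ} (hK : IsSmoothingKernel K) :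
    biasConst (nuTilde K) ≠ 0 := by
  have hshift : ∀ j : ℕ, moment (fun u => u * (K u * halfLine u)) j = nuTilde K (j + 1) := by
    intro j
    rw [nuTilde_eq, moment, moment]
    congr 1
    ext u
    ring
  have h := moment_det_pos (m := fun u => u * (K u * halfLine u)) (fun u => ?_) (fun j => ?_) ?_
  · rw [hshift, hshift, hshift] at h
    have hd := hK.nuTilde_det_pos
    refine div_ne_zero (fun hc => ?_) hd.ne'
    norm_num at h
    linarith
  · by_cases h0 : 0 < u
    · exact mul_nonneg h0.le (mul_nonneg (hK.nonneg u) (halfLine_nonneg u))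
    · simp [halfLine, h0]
  · refine (hK.integrable (j + 1) measurable_halfLine halfLine_nonneg halfLine_le_one).congr
      (ae_of_all _ fun u => ?_)
    simp only
    ring
  · rw [hshift]
    exact hK.nuTilde_one_pos

theorem C1Tilde_eq (K : ℝ → ℝ) : C1Tilde K = 1 / 4 * biasConst (nuTilde K) ^ 2 := rfl

theorem C2Tilde_eq (K : ℝ → ℝ) : C2Tilde K = varConst (nuTilde K) (kpiTilde K) := by
  rw [C2Tilde, varConst]
  ring

theorem C1_eq (K : ℝ → ℝ) : C1 K = 1 / 4 * biasConst (nu K) ^ 2 := rfl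

theorem C2_eq (K : ℝ → ℝ) : C2 K = 2 * varConst (nu K) (kpi K) := by
  rw [C2, varConst]
  ring

theorem IsSmoothingKernel.C1Tilde_pos {K : ℝ → ℝ} (hK : IsSmoothingKernel K) :
    0 < C1Tilde K := by
  have := hK.biasConst_nuTilde_ne
  rw [C1Tilde_eq]
  positivity

/-- The numerator is the integral of (ν̃₂ - ν̃₁ u)² K(u)² over the positive half-line. -/
theorem IsSmoothingKernel.C2Tilde_pos {K : ℝ → ℝ} (hK : IsSmoothingKernel K) :
    0 < C2Tilde K := by
  have h := moment_quadratic_pos (m := fun u => K u ^ 2 * halfLine u)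
    (fun u => mul_nonneg (sq_nonneg _) (halfLine_nonneg u))
    (fun j => hK.sq.integrable j measurable_halfLine halfLine_nonneg halfLine_le_one)
    hK.sq.moment_halfLine_pos (a := nuTilde K 2) (b := -nuTilde K 1)
    (Or.inl hK.nuTilde_two_pos.ne')
  rw [← kpiTilde_eq] at h
  rw [C2Tilde_eq, varConst]
  have hd := hK.nuTilde_det_pos
  refine div_pos ?_ (by positivity)
  nlinarith

theorem IsSmoothingKernel.nu_odd {K : ℝ → ℝ} (hK : IsSmoothingKernel K) {j : ℕ} (hj : Odd j) :
    nu K j = 0 := by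
  have h := integral_neg_eq_self (fun u : ℝ => u ^ j * K u) volume
  have h2 : ∀ u : ℝ, (-u) ^ j * K (-u) = -(u ^ j * K u) := fun u => by
    rw [hK.symmetric, hj.neg_pow]; ring
  simp only [h2] at h
  rw [integral_neg] at h
  rw [nu]
  linarith

theorem IsSmoothingKernel.integrable_pow_mul {K : ℝ → ℝ} (hK : IsSmoothingKernel K) (j : ℕ) :
    Integrable fun u => u ^ j * K u := by
  simpa using hK.integrable j (w := fun _ => 1) measurable_const (by simp) (by simp)

theorem IsSmoothingKernel.nu_det_pos {K : ℝ → ℝ} (hK : IsSmoothingKernel K) :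
    0 < nu K 0 * nu K 2 - nu K 1 ^ 2 :=
  moment_det_pos hK.nonneg hK.integrable_pow_mul hK.integral_pos

theorem IsSmoothingKernel.nu_two_pos {K : ℝ → ℝ} (hK : IsSmoothingKernel K) : 0 < nu K 2 := by
  have h := moment_quadratic_pos hK.nonneg hK.integrable_pow_mul hK.integral_pos
    (a := 0) (b := 1) (Or.inr one_ne_zero)
  change 0 < moment K 2
  linarith

theorem IsSmoothingKernel.C1_pos {K : ℝ → ℝ} (hK : IsSmoothingKernel K) : 0 < C1 K := by
  have h2 := hK.nu_two_pos
  have hd := hK.nu_det_pos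
  have : biasConst (nu K) ≠ 0 := by
    refine div_ne_zero ?_ hd.ne'
    rw [hK.nu_odd odd_one]
    have : nu K 2 ^ 2 ≠ 0 := by positivity
    simpa using this
  rw [C1_eq]
  positivity

theorem IsSmoothingKernel.C2_pos {K : ℝ → ℝ} (hK : IsSmoothingKernel K) : 0 < C2 K := by
  have h := moment_quadratic_pos hK.sq.nonneg hK.sq.integrable_pow_mul hK.sq.integral_pos
    (a := nu K 2) (b := -nu K 1) (Or.inl hK.nu_two_pos.ne')
  have e : moment (fun u => K u ^ 2) = kpi K := rfl
  rw [e] at h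
  rw [C2_eq, varConst]
  have hd := hK.nu_det_pos
  refine mul_pos two_pos (div_pos ?_ (by positivity))
  nlinarith

/-- Every monomial has even total index, so reflection changes nothing: in the discontinuity design
the control arm has the constants of the treated arm. -/
theorem biasConst_neg_one_pow_mul (n : ℕ → ℝ) :
    biasConst (fun j => (-1) ^ j * n j) = biasConst n := by
  rw [biasConst, biasConst]
  congr 1 <;> ring

theorem varConst_neg_one_pow_mul (n s : ℕ → ℝ) :
    varConst (fun j => (-1) ^ j * n j) (fun j => (-1) ^ j * s j) = varConst n s := by
  rw [varConst, varConst]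
  congr 1 <;> ring

theorem biasConst_const_mul {c : ℝ} (hc : c ≠ 0) (n : ℕ → ℝ) :
    biasConst (fun j => c * n j) = biasConst n := by
  rw [biasConst, biasConst, ← mul_div_mul_left (n 2 ^ 2 - n 1 * n 3) _ (pow_ne_zero 2 hc)]
  congr 1 <;> ring

/-- Homogeneity of degree 3 - 4 = -1. In the tie-breaker design this produces the factors 1/p and
1/(1 - p); the halves come from the 2 in `C2_eq`. -/
theorem varConst_const_mul {c : ℝ} (hc : c ≠ 0) (n s : ℕ → ℝ) :
    varConst (fun j => c * n j) (fun j => c * s j) = varConst n s / c := by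
  rw [varConst, varConst, div_div, ← mul_div_mul_left
    (n 2 ^ 2 * s 0 - 2 * n 1 * n 2 * s 1 + n 1 ^ 2 * s 2) _ (pow_ne_zero 3 hc)]
  congr 1 <;> ring

/-! ### The two designs -/

theorem measurable_rddProb (t : ℝ) : Measurable (rddProb t) :=
  Measurable.ite measurableSet_Ioi measurable_const measurable_const

theorem rddProb_nonneg (t x : ℝ) : 0 ≤ rddProb t x := by
  rw [rddProb]; split_ifs <;> norm_num

theorem rddProb_le_one (t x : ℝ) : rddProb t x ≤ 1 := by
  rw [rddProb]; split_ifs <;> norm_num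

theorem measurable_tbdProb (t Δ p : ℝ) : Measurable (tbdProb t Δ p) := by
  refine Measurable.ite ?_ measurable_const (Measurable.ite ?_ measurable_const measurable_const)
  · exact measurableSet_le (by fun_prop) (by fun_prop)
  · exact measurableSet_lt (by fun_prop) (by fun_prop)

theorem tbdProb_nonneg {p : ℝ} (hp : 0 ≤ p) (t Δ x : ℝ) : 0 ≤ tbdProb t Δ p x := by
  rw [tbdProb]; split_ifs <;> simp [hp]

theorem tbdProb_le_one {p : ℝ} (hp : p ≤ 1) (t Δ x : ℝ) : tbdProb t Δ p x ≤ 1 := by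
  rw [tbdProb]; split_ifs <;> simp [hp]

/-- A jump at the threshold looks the same at every scale. -/
theorem rddProb_rescaled (t u : ℝ) {h : ℝ} (hh : 0 < h) : rddProb t (t + h * u) = halfLine u := by
  have : t < t + h * u ↔ 0 < u := by
    rw [lt_add_iff_pos_right]
    exact mul_pos_iff_of_pos_left hh
  simp only [rddProb, halfLine, this]

/-- As the bandwidth shrinks, every fixed rescaled point falls inside the experimental window; hence
`Δ` leaves no trace in the limit. -/
theorem eventually_tbdProb_rescaled (t p u : ℝ) {Δ : ℝ} (hΔ : 0 < Δ) :
    ∀ᶠ h in 𝓝[>] (0 : ℝ), tbdProb t Δ p (t + h * u) = p := by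
  have h0 : Tendsto (fun h : ℝ => |h * u|) (𝓝[>] 0) (𝓝 0) := by
    have : Tendsto (fun h : ℝ => |h * u|) (𝓝 0) (𝓝 |0 * u|) := Continuous.tendsto (by fun_prop) 0
    rw [zero_mul, abs_zero] at this
    exact this.mono_left nhdsWithin_le_nhds
  filter_upwards [h0.eventually_lt_const hΔ] with h hh
  have h1 := (abs_lt.1 hh).1
  rw [tbdProb, add_sub_cancel_left, if_neg (by linarith), if_pos hh]

/-- The rescaled mean squared error at the bandwidth with scale `a` in its limit. -/
def limitMSE (c₁ c₂ g s f a : ℝ) : ℝ := a ^ 4 * (c₁ * g ^ 2) + c₂ * s / f / a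

section Experiment

variable {Ω : Type*} [MeasurableSpace Ω] {P : Measure Ω} [IsProbabilityMeasure P]
  {pop : Superpopulation} {X Yp Ym Z : ℕ → Ω → ℝ} {K : ℝ → ℝ} {t a : ℝ} {G : ℕ → Ω → ℝ}

theorem IsExperiment.tendsto_condMSE_rdd (hE : IsExperiment P pop (rddProb t) X Yp Ym Z)
    (hreg : pop.IsRegularAt t) (hK : IsSmoothingKernel K) (ha : 0 < a)
    (hG : Tendsto (fun q : ℕ × Ω => G q.1 q.2) (probFilter P) (𝓝 a)) :
    Tendsto (fun q : ℕ × Ω => (q.1 : ℝ) ^ (4 / 5 : ℝ) *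
        condMSE P pop K t X Yp Ym Z (G q.1 q.2 * (q.1 : ℝ) ^ (-(1 / 5) : ℝ)) q.1 q.2)
      (probFilter P) (𝓝 (limitMSE (C1Tilde K) (C2Tilde K) (pop.curvatureGap t)
        (pop.varPlus t + pop.varMinus t) (pop.density t) a)) := by
  set n : Bool → ℕ → ℝ := fun b j => if b then nuTilde K j else (-1) ^ j * nuTilde K j with hn
  set s : Bool → ℕ → ℝ := fun b j => if b then kpiTilde K j else (-1) ^ j * kpiTilde K j with hs
  have key := hE.tendsto_condMSE (measurable_rddProb t) (rddProb_nonneg t) (rddProb_le_one t) hreg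
    hK (w := armProb halfLine) (measurable_armProb measurable_halfLine)
    (armProb_nonneg halfLine_nonneg halfLine_le_one)
    (armProb_le_one halfLine_nonneg halfLine_le_one) (fun b => ae_of_all _ fun u => ?_)
    (n := n) (s := s) (fun b j => ?_) (fun b j => ?_) (fun b => ?_) ha hG
  · convert key using 2
    have e1 : biasConst (n false) = biasConst (nuTilde K) := biasConst_neg_one_pow_mul _
    have e2 : varConst (n false) (s false) = varConst (nuTilde K) (kpiTilde K) :=
      varConst_neg_one_pow_mul _ _
    have e3 : n true = nuTilde K := rfl
    have e4 : s true = kpiTilde K := rfl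
    rw [e1, e2, e3, e4, limitMSE, C1Tilde_eq, C2Tilde_eq, Superpopulation.curvatureGap]
    ring
  · refine tendsto_const_nhds.congr' ?_
    filter_upwards [self_mem_nhdsWithin] with h hh
    simp only [armProb, rddProb_rescaled t u hh]
  · have h1 := moment_mul_one_sub_halfLine hK.symmetric j
    rw [← nuTilde_eq] at h1
    cases b
    · simp only [hn, Bool.false_eq_true, if_false, ← h1, moment, armProb, mul_assoc]
    · simp only [hn, if_true, nuTilde_eq, moment, armProb, mul_assoc]
  · have h1 := moment_mul_one_sub_halfLine (K := fun u => K u ^ 2) hK.sq.symmetric j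
    rw [← kpiTilde_eq] at h1
    cases b
    · simp only [hs, Bool.false_eq_true, if_false, ← h1, moment, armProb, mul_assoc]
    · simp only [hs, if_true, kpiTilde_eq, moment, armProb, mul_assoc]
  · have := hK.nuTilde_det_pos
    cases b
    · simp only [hn, Bool.false_eq_true, if_false]
      linarith
    · exact this

theorem IsExperiment.tendsto_condMSE_tbd {Δ p : ℝ} (hΔ : 0 < Δ) (hp0 : 0 < p) (hp1 : p < 1)
    (hE : IsExperiment P pop (tbdProb t Δ p) X Yp Ym Z)
    (hreg : pop.IsRegularAt t) (hK : IsSmoothingKernel K) (ha : 0 < a)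
    (hG : Tendsto (fun q : ℕ × Ω => G q.1 q.2) (probFilter P) (𝓝 a)) :
    Tendsto (fun q : ℕ × Ω => (q.1 : ℝ) ^ (4 / 5 : ℝ) *
        condMSE P pop K t X Yp Ym Z (G q.1 q.2 * (q.1 : ℝ) ^ (-(1 / 5) : ℝ)) q.1 q.2)
      (probFilter P) (𝓝 (limitMSE (C1 K) (C2 K) (pop.curvatureGap t)
        (1 / (2 * p) * pop.varPlus t + 1 / (2 * (1 - p)) * pop.varMinus t) (pop.density t) a)) := by
  have hpos : ∀ b, 0 < armProb (fun _ => p) b 0 := by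
    intro b
    cases b
    · simpa [armProb] using hp1
    · simpa [armProb] using hp0
  have hc : ∀ b u, armProb (fun _ => p) b u = armProb (fun _ => p) b 0 := by
    intro b u
    cases b <;> rfl
  set n : Bool → ℕ → ℝ := fun b j => armProb (fun _ => p) b 0 * nu K j with hn
  set s : Bool → ℕ → ℝ := fun b j => armProb (fun _ => p) b 0 * kpi K j with hs
  have key := hE.tendsto_condMSE (measurable_tbdProb t Δ p) (tbdProb_nonneg hp0.le t Δ)
    (tbdProb_le_one hp1.le t Δ) hreg
    hK (w := armProb fun _ => p) (measurable_armProb measurable_const)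
    (armProb_nonneg (fun _ => hp0.le) (fun _ => hp1.le))
    (armProb_le_one (fun _ => hp0.le) (fun _ => hp1.le)) (fun b => ae_of_all _ fun u => ?_)
    (n := n) (s := s) (fun b j => ?_) (fun b j => ?_) (fun b => ?_) ha hG
  · convert key using 2
    have e1 : ∀ b, biasConst (n b) = biasConst (nu K) := fun b =>
      biasConst_const_mul (hpos b).ne' _
    have e2 : ∀ b, varConst (n b) (s b) =
        varConst (nu K) (kpi K) / armProb (fun _ => p) b 0 := fun b =>
      varConst_const_mul (hpos b).ne' _ _
    have e3 : armProb (fun _ => p) true 0 = p := rfl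
    have e4 : armProb (fun _ => p) false 0 = 1 - p := rfl
    rw [e1, e1, e2, e2, e3, e4, limitMSE, C1_eq, C2_eq, Superpopulation.curvatureGap]
    have h1 : (1 - p) ≠ 0 := by linarith
    have h2 := hreg.density_pos.ne'
    field_simp
    ring
  · refine tendsto_const_nhds.congr' ?_
    filter_upwards [eventually_tbdProb_rescaled t p u hΔ] with h hh
    simp only [armProb, hh]
  · simp only [hc b, hn, nu]
    rw [integral_mul_const, mul_comm]
  · simp only [hc b, hs, kpi]
    rw [integral_mul_const, mul_comm]
  · have h1 := mul_pos (pow_pos (hpos b) 2) hK.nu_det_pos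
    simp only [hn]
    linarith

end Experiment

/-! ### The ratio of the optimal mean squared errors -/

theorem rpow_fifth_pow {x : ℝ} (hx : 0 ≤ x) : (x ^ (1 / 5 : ℝ)) ^ 5 = x := by
  rw [← Real.rpow_natCast, ← Real.rpow_mul hx]
  norm_num

theorem rpow_four_fifths_pow {x : ℝ} (hx : 0 ≤ x) : (x ^ (4 / 5 : ℝ)) ^ 5 = x ^ 4 := by
  rw [← Real.rpow_natCast, ← Real.rpow_mul hx, ← Real.rpow_natCast]
  norm_num

theorem rpow_neg_four_fifths_pow {x : ℝ} (hx : 0 ≤ x) :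
    (x ^ (-(4 / 5) : ℝ)) ^ 5 = (x ^ 4)⁻¹ := by
  rw [Real.rpow_neg hx, inv_pow, rpow_four_fifths_pow hx]

/-- The condition on `a ^ 5` says that the derivative of `limitMSE` in `a` vanishes, which makes the
variance term four times the squared bias term. -/
theorem limitMSE_optimal {c₁ c₂ g s f : ℝ} (hc₁ : 0 < c₁) (hc₂ : 0 < c₂) (hg : g ≠ 0)
    (hs : 0 < s) (hf : 0 < f) {a : ℝ} (ha : 0 < a) (ha5 : a ^ 5 = c₂ / (4 * c₁) * (s / (f * g ^ 2))) :
    limitMSE c₁ c₂ g s f a = 5 * c₁ * g ^ 2 * a ^ 4 := by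
  have h : c₂ * s / f = 4 * c₁ * g ^ 2 * a ^ 5 := by
    rw [ha5]
    field_simp
  rw [limitMSE, h]
  field_simp
  ring

theorem optimal_scale_pow {c₁ c₂ s d : ℝ} (hc₁ : 0 < c₁) (hc₂ : 0 < c₂) (hs : 0 < s) (hd : 0 < d) :
    ((c₂ / (4 * c₁)) ^ (1 / 5 : ℝ) * (s / d) ^ (1 / 5 : ℝ)) ^ 5 = c₂ / (4 * c₁) * (s / d) := by
  rw [mul_pow, rpow_fifth_pow (by positivity), rpow_fifth_pow (by positivity)]

theorem limit_ratio_eq {b₁ b₂ c₁ c₂ g v s f a a' : ℝ} (hb₁ : 0 < b₁) (hb₂ : 0 < b₂)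
    (hc₁ : 0 < c₁) (hc₂ : 0 < c₂) (hg : g ≠ 0) (hv : 0 < v) (hs : 0 < s) (hf : 0 < f)
    (ha : 0 < a) (ha' : 0 < a')
    (ha5 : a ^ 5 = b₂ / (4 * b₁) * (v / (f * g ^ 2)))
    (ha5' : a' ^ 5 = c₂ / (4 * c₁) * (s / (f * g ^ 2))) :
    limitMSE b₁ b₂ g v f a / limitMSE c₁ c₂ g s f a' =
      (b₁ * b₂ ^ 4 / (c₁ * c₂ ^ 4)) ^ (1 / 5 : ℝ) * (s / v) ^ (-(4 / 5) : ℝ) := by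
  rw [limitMSE_optimal hb₁ hb₂ hg hv hf ha ha5, limitMSE_optimal hc₁ hc₂ hg hs hf ha' ha5']
  -- Both sides are positive, so fifth powers may be compared; this removes the fractional
  -- exponents, and only `a ^ 5` and `a' ^ 5` remain.
  rw [← pow_left_inj₀ (by positivity) (by positivity) (by norm_num : 5 ≠ 0), mul_pow,
    rpow_fifth_pow (by positivity), rpow_neg_four_fifths_pow (by positivity), div_pow, mul_pow,
    mul_pow (5 * c₁ * g ^ 2), ← pow_mul a, mul_comm 4 5, pow_mul a, ha5, ← pow_mul a',
    mul_comm 4 5, pow_mul a', ha5']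
  field_simp

theorem tendsto_atTop_of_tendsto_div {m : ℕ → ℕ} {θ : ℝ} (hθ : 0 < θ)
    (hm : Tendsto (fun N : ℕ => (m N : ℝ) / (N : ℝ)) atTop (𝓝 θ)) : Tendsto m atTop atTop := by
  have h1 : Tendsto (fun N : ℕ => (m N : ℝ) / (N : ℝ) * N) atTop atTop :=
    hm.pos_mul_atTop hθ tendsto_natCast_atTop_atTop
  have h2 : Tendsto (fun N : ℕ => (m N : ℝ)) atTop atTop := by
    refine h1.congr' ?_
    filter_upwards [eventually_gt_atTop 0] with N hN
    have : (N : ℝ) ≠ 0 := by positivity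
    field_simp
  exact tendsto_natCast_atTop_iff.1 h2

end TieBreaker

end

/-! ### The limit of the ratio of the two mean squared errors -/

theorem theoremC1 {Ω : Type*} [MeasurableSpace Ω] (P : Measure Ω) [IsProbabilityMeasure P]
    (pop : TieBreaker.Superpopulation) (K : ℝ → ℝ) (t Δ p θ : ℝ)
    (hreg : pop.IsRegularAt t) (hK : TieBreaker.IsSmoothingKernel K)
    (hΔ : 0 < Δ) (hp0 : 0 < p) (hp1 : p < 1) (hθ : 0 < θ)
    -- the regression discontinuity design
    (X Yp Ym Z : ℕ → Ω → ℝ)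
    (hRDD : TieBreaker.IsExperiment P pop (TieBreaker.rddProb t) X Yp Ym Z)
    (gRDD : ℕ → Ω → ℝ)
    (hgRDD : TendstoInMeasure P gRDD atTop (fun _ => pop.gammaRDD t))
    -- the tie-breaker design
    (X' Yp' Ym' Z' : ℕ → Ω → ℝ)
    (hTBD : TieBreaker.IsExperiment P pop (TieBreaker.tbdProb t Δ p) X' Yp' Ym' Z')
    (gTBD : ℕ → Ω → ℝ)
    (hgTBD : TendstoInMeasure P gTBD atTop (fun _ => pop.gammaTBD t p))
    -- the size of the tie-breaker design, `θ N` up to rounding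
    (m : ℕ → ℕ) (hm : Tendsto (fun N : ℕ => (m N : ℝ) / (N : ℝ)) atTop (𝓝 θ)) :
    TendstoInMeasure P
      (fun (N : ℕ) (ω : Ω) =>
        TieBreaker.condMSE P pop K t X Yp Ym Z
            (TieBreaker.bandwidthRDD K (gRDD N ω) N) N ω /
          TieBreaker.condMSE P pop K t X' Yp' Ym' Z'
            (TieBreaker.bandwidthTBD K (gTBD (m N) ω) (m N)) (m N) ω)
      atTop
      (fun _ =>
        θ ^ (4 / 5 : ℝ) *
          (TieBreaker.C1Tilde K * TieBreaker.C2Tilde K ^ 4 /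
            (TieBreaker.C1 K * TieBreaker.C2 K ^ 4)) ^ (1 / 5 : ℝ) *
          (pop.relVar t / (2 * p) + (1 - pop.relVar t) / (2 * (1 - p))) ^ (-(4 / 5) : ℝ)) := by
  have hs := add_pos hreg.varPlus_pos hreg.varMinus_pos
  have hf := hreg.density_pos
  have hg : pop.curvatureGap t ≠ 0 := sub_ne_zero.2 hreg.curvature_ne
  have hp1' : 0 < 1 - p := sub_pos.2 hp1
  have hsp : 0 < 1 / (2 * p) * pop.varPlus t + 1 / (2 * (1 - p)) * pop.varMinus t :=
    add_pos (mul_pos (by positivity) hreg.varPlus_pos) (mul_pos (by positivity) hreg.varMinus_pos)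
  have hd : 0 < pop.density t * pop.curvatureGap t ^ 2 := by positivity
  have hb₁ := hK.C1Tilde_pos
  have hb₂ := hK.C2Tilde_pos
  have hc₁ := hK.C1_pos
  have hc₂ := hK.C2_pos
  obtain ⟨cR, hcR⟩ : ∃ c, c = (TieBreaker.C2Tilde K / (4 * TieBreaker.C1Tilde K)) ^ (1 / 5 : ℝ) :=
    ⟨_, rfl⟩
  obtain ⟨cT, hcT⟩ : ∃ c, c = (TieBreaker.C2 K / (4 * TieBreaker.C1 K)) ^ (1 / 5 : ℝ) := ⟨_, rfl⟩
  obtain ⟨a, ha_def⟩ : ∃ a, a = cR * pop.gammaRDD t := ⟨_, rfl⟩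
  obtain ⟨a', ha'_def⟩ : ∃ a, a = cT * pop.gammaTBD t p := ⟨_, rfl⟩
  have ha : 0 < a := by
    rw [ha_def, hcR]
    exact mul_pos (by positivity) (Real.rpow_pos_of_pos (div_pos hs hd) _)
  have ha' : 0 < a' := by
    rw [ha'_def, hcT]
    exact mul_pos (by positivity) (Real.rpow_pos_of_pos (div_pos hsp hd) _)
  have ha5 := TieBreaker.optimal_scale_pow hb₁ hb₂ hs hd
  rw [← hcR, ← TieBreaker.Superpopulation.gammaRDD, ← ha_def] at ha5
  have ha5' := TieBreaker.optimal_scale_pow hc₁ hc₂ hsp hd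
  rw [← hcT, ← TieBreaker.Superpopulation.gammaTBD, ← ha'_def] at ha5'
  have hmtop := TieBreaker.tendsto_atTop_of_tendsto_div hθ hm
  have hGR : Tendsto (fun q : ℕ × Ω => cR * gRDD q.1 q.2) (TieBreaker.probFilter P) (𝓝 a) := by
    rw [ha_def]
    exact (TieBreaker.tendstoInMeasure_const_iff.1 hgRDD).const_mul cR
  have hGT : Tendsto (fun q : ℕ × Ω => cT * gTBD q.1 q.2) (TieBreaker.probFilter P) (𝓝 a') := by
    rw [ha'_def]
    exact (TieBreaker.tendstoInMeasure_const_iff.1 hgTBD).const_mul cT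
  have hR := hRDD.tendsto_condMSE_rdd (G := fun N ω => cR * gRDD N ω) hreg hK ha hGR
  -- The tie-breaker limit is taken in its own sample size and then read along `m N`.
  have hT := (TieBreaker.IsExperiment.tendsto_condMSE_tbd (G := fun N ω => cT * gTBD N ω)
    hΔ hp0 hp1 hTBD hreg hK ha' hGT).comp
    (TieBreaker.tendsto_map_fst_probFilter (P := P) hmtop)
  have hTpos : TieBreaker.limitMSE (TieBreaker.C1 K) (TieBreaker.C2 K) (pop.curvatureGap t)
      (1 / (2 * p) * pop.varPlus t + 1 / (2 * (1 - p)) * pop.varMinus t) (pop.density t) a' ≠ 0 := by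
    rw [TieBreaker.limitMSE]
    positivity
  have hsize : Tendsto (fun q : ℕ × Ω => ((m q.1 : ℝ) / (q.1 : ℝ)) ^ (4 / 5 : ℝ))
      (TieBreaker.probFilter P) (𝓝 (θ ^ (4 / 5 : ℝ))) :=
    (hm.rpow_const (Or.inl hθ.ne')).comp TieBreaker.tendsto_fst_probFilter
  have hlim := hsize.mul (hR.div hT hTpos)
  rw [TieBreaker.limit_ratio_eq hb₁ hb₂ hc₁ hc₂ hg hs hsp hf ha ha' ha5 ha5', ← mul_assoc] at hlim
  have hrel : (1 / (2 * p) * pop.varPlus t + 1 / (2 * (1 - p)) * pop.varMinus t) /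
      (pop.varPlus t + pop.varMinus t) =
      pop.relVar t / (2 * p) + (1 - pop.relVar t) / (2 * (1 - p)) := by
    rw [TieBreaker.Superpopulation.relVar]
    have h1 := hs.ne'
    have h2 := hp1'.ne'
    field_simp
    ring
  rw [hrel] at hlim
  rw [TieBreaker.tendstoInMeasure_const_iff]
  -- The ratio in `hlim` carries the normalizations N^(4/5) and (m N)^(4/5), which cancel against
  -- `(m N / N) ^ (4/5)` as soon as both sample sizes are positive.
  refine hlim.congr' ?_
  filter_upwards [TieBreaker.tendsto_fst_probFilter.eventually (eventually_gt_atTop 0),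
    TieBreaker.tendsto_fst_probFilter.eventually (hmtop.eventually (eventually_gt_atTop 0))]
    with q h1 h2
  have h1' : (0 : ℝ) < q.1 := by exact_mod_cast h1
  have h2' : (0 : ℝ) < m q.1 := by exact_mod_cast h2
  have h3 : (0 : ℝ) < (q.1 : ℝ) ^ (4 / 5 : ℝ) := by positivity
  have h4 : (0 : ℝ) < (m q.1 : ℝ) ^ (4 / 5 : ℝ) := by positivity
  rw [Real.div_rpow h2'.le h1'.le]
  simp only [Pi.div_apply, Function.comp_apply, TieBreaker.bandwidthRDD, TieBreaker.bandwidthTBD,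
    ← hcR, ← hcT]
  rw [mul_div_mul_comm, ← mul_assoc, div_mul_div_cancel₀ h3.ne', div_self h4.ne', one_mul]
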